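/- Let $S=\{1,\dots,n\}$ with $n\ge 2$ and let $1\le k\le n$. A similarity function is a symmetric $s:S\times S\to[0,\infty)$ with $s(i,j)>0$ for $i\ne j$. A partitioning function $F$ assigns to every $s$ a partition $F(s,k)$ of $S$ into $k$ non-empty clusters. $F$ is * *Scale-Invariant* if $F(\alpha s,k)=F(s,k)$ for all $s$ and all $\alpha>0$; * *Consistent* if $F(s',k)=F(s,k)$ whenever $s'(i,j)\ge s(i,j)$ for all $i,j$ in the same cluster of $F(s,k)$ and $s'(i,j)\le s(i,j)$ for all $i,j$ in different clusters of $F(s,k)$; * *$k$-Rich* if $\{F(s,k): s\}$ is the set of all partitions of $S$ into $k$ non-empty clusters; * *MCT-Consistent* if $F(s,k)=F(s',k)$ whenever the trees $\mathrm{MCT}(s)$ and $\mathrm{MCT}(s')$ have the same minimum $k$-cut. Here $\mathrm{MCT}(s)$ is the canonical minimum cut tree of the complete graph on $S$ with edge weights $s$: the output of the Gomory–Hu algorithm when every step treats the lexicographically first pair $u<v$ of points that still lie in one supernode, and uses the minimum $u$-$v$ cut with the inclusion-least side of $u$. The minimum $k$-cut of a weighted tree on $S$ is the partition of $S$ into the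 $k$ connected components that remain when the $k-1$ smallest edges are removed (ties between edges of equal weight are broken lexicographically). *Max-Sum* is the partitioning function whose value at $(s,k)$ is the minimum $k$-cut of $\mathrm{MCT}(s)$. *Single-Linkage* starts from singletons and merges $n-k$ times the two clusters that contain the most similar pair of points in different clusters (the lexicographically first such pair in case of ties). The *constant partitioning* has the clusters $\{1,\dots,n-k+1\},\{n-k+2\},\dots,\{n\}$ for every $s$. For a permutation $\sigma$ of the set of $k$-partitionings of $S$, the *MCT cuts* function $F_\sigma$ is Max-Sum followed by $\sigma$. **Theorem 2.** None of Consistency, MCT-Consistency and $k$-Richness can be dropped from the characterization of Max-Sum. More precisely: 1. (Consistency.) For every $\sigma$, $F_\sigma$ is a partitioning function that is Scale-Invariant, $k$-Rich and MCT-Consistent; if $\sigma\neq\mathrm{id}$, then $F_\sigma$ differs from Max-Sum and is not Consistent. If $2\le k\le n-1$, such a $\sigma\ne\mathrm{id}$ exists. 2. (MCT-Consistency.) Single-Linkage is a partitioning function that is Scale-Invariant, Consistent and $k$-Rich; if $2\le k\le n-1$, it differs from Max-Sum and is not MCT-Consistent. 3. ($k$-Richness.) The constant partitioning is a partitioning function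 that is Scale-Invariant, Consistent and MCT-Consistent; if $2\le k\le n-1$, it differs from Max-Sum and is not $k$-Rich. (For $k=1$ and $k=n$ there is only one $k$-partitioning, so all partitioning functions coincide.) -/

import Mathlib

noncomputable section

namespace Clustering

/-- A similarity function on the point set `S = Fin n`: symmetric, with values in the nonnegative
reals, and positive on pairs of distinct points. -/
structure Similarity (n : ℕ) where
  toFun : Fin n → Fin n → ℝ
  symm : ∀ i j, toFun i j = toFun j i
  nonneg : ∀ i j, 0 ≤ toFun i j
  pos : ∀ i j, i ≠ j → 0 < toFun i j

/-- The similarity function `α · s`. -/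
def Similarity.scale {n : ℕ} (α : ℝ) (hα : 0 < α) (s : Similarity n) : Similarity n where
  toFun i j := α * s.toFun i j
  symm i j := by rw [s.symm]
  nonneg i j := mul_nonneg hα.le (s.nonneg i j)
  pos i j h := mul_pos hα (s.pos i j h)

/-- Partitions of the point set into nonempty disjoint subsets. -/
abbrev Partition (n : ℕ) := Finpartition (Finset.univ : Finset (Fin n))

/-- `P` is a `k`-partitioning. -/
def IsKPartition {n : ℕ} (k : ℕ) (P : Partition n) : Prop := P.parts.card = k

/-- The `k`-partitionings of the point set. -/
abbrev KPartition (n k : ℕ) := {P : Partition n // IsKPartition k P}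

/-- `i` and `j` belong to the same cluster of `P`. -/
def SameCluster {n : ℕ} (P : Partition n) (i j : Fin n) : Prop :=
  ∃ B ∈ P.parts, i ∈ B ∧ j ∈ B

/-! ### Partitioning functions and their properties

The number `k` of clusters is fixed: `F` stands for the function `s ↦ F(s, k)`. -/

/-- `F` returns a `k`-partitioning on every similarity function. -/
def IsPartitioningFunction {n : ℕ} (k : ℕ) (F : Similarity n → Partition n) : Prop :=
  ∀ s, IsKPartition k (F s)

/-- Scale-Invariance. -/
def ScaleInvariant {n : ℕ} (F : Similarity n → Partition n) : Prop :=
  ∀ (s : Similarity n) (α : ℝ) (hα : 0 < α), F (s.scale α hα) = F s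

/-- `s'` is a `P`-transformation of `s`. -/
def IsTransformation {n : ℕ} (P : Partition n) (s s' : Similarity n) : Prop :=
  (∀ i j, SameCluster P i j → s.toFun i j ≤ s'.toFun i j) ∧
  (∀ i j, ¬ SameCluster P i j → s'.toFun i j ≤ s.toFun i j)

/-- Consistency. -/
def Consistent {n : ℕ} (F : Similarity n → Partition n) : Prop :=
  ∀ s s' : Similarity n, IsTransformation (F s) s s' → F s' = F s

/-- `k`-Richness: the range of `F` is the set of all `k`-partitionings. -/
def KRich {n : ℕ} (k : ℕ) (F : Similarity n → Partition n) : Prop :=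
  Set.range F = {P | IsKPartition k P}

/-! ### The canonical minimum cut tree (Gomory-Hu) -/

/-- The total weight of the edges of the complete graph `G_s` that cross the cut `(C, Cᶜ)`. -/
def cutValue {n : ℕ} (s : Similarity n) (C : Finset (Fin n)) : ℝ :=
  ∑ i ∈ C, ∑ j ∈ Cᶜ, s.toFun i j

/-- A weighted edge `(a, b, w)` between `a` and `b`, of weight `w`. -/
abbrev WEdge (n : ℕ) := Fin n × Fin n × ℝ

/-- The intermediate data of the Gomory-Hu algorithm: a partition of the points into supernodes,
each named by one of its points (`node i` is the name of the supernode that contains `i`), and the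
list of the weighted edges of a tree on the names of the supernodes. -/
structure GHState (n : ℕ) where
  node : Fin n → Fin n
  edges : List (WEdge n)

/-- A single supernode (named by the first point), no edges. -/
def GHState.init (n : ℕ) : GHState n where
  node i := ⟨0, i.pos⟩
  edges := []

/-- All pairs of points, in lexicographical order. -/
def lexPairs (n : ℕ) : List (Fin n × Fin n) := List.finRange n ×ˢ List.finRange n

/-- `C` is a `u`-`v` cut in the graph in which, for each connected component of the current tree
minus the supernode `X` of `u`, all the points in the component are contracted to one point:
outside `X`, `C` splits neither a supernode nor two supernodes that are joined by a tree edge. -/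
def GHState.IsContractedCut {n : ℕ} (st : GHState n) (u v : Fin n) (C : Finset (Fin n)) : Prop :=
  u ∈ C ∧ v ∉ C ∧
  (∀ i, st.node i ≠ st.node u → (i ∈ C ↔ st.node i ∈ C)) ∧
  (∀ e ∈ st.edges, e.1 ≠ st.node u → e.2.1 ≠ st.node u → (e.1 ∈ C ↔ e.2.1 ∈ C))

/-- `C` is a minimum `u`-`v` cut of the contracted graph. -/
def GHState.IsMinCut {n : ℕ} (s : Similarity n) (st : GHState n) (u v : Fin n)
    (C : Finset (Fin n)) : Prop :=
  st.IsContractedCut u v C ∧ ∀ D, st.IsContractedCut u v D → cutValue s C ≤ cutValue s D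

open scoped Classical in
/-- The first minimum `u`-`v` cut of the contracted graph, in the colexicographical order of the
sides that contain `u`. (This order extends inclusion, so it is also the minimum cut with the least
side of `u`, which is the one that a maximum flow from `u` to `v` exhibits.) If there is no cut,
which does not happen in the algorithm, the value is `{u}`. -/
def GHState.minCut {n : ℕ} (s : Similarity n) (st : GHState n) (u v : Fin n) : Finset (Fin n) :=
  if h : ((Finset.univ.filter (st.IsMinCut s u v)).image toColex).Nonempty then
    ofColex (((Finset.univ.filter (st.IsMinCut s u v)).image toColex).min' h)
  else {u}

/-- Split the supernode `X` of `u` and `v` along the cut `C`: the points of `X` outside `C` form a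
new supernode, named `v`. The two halves of `X` are joined by an edge whose weight is the value of
the cut, and each old edge at `X` is attached to the half of `X` on its side of the cut. -/
def GHState.split {n : ℕ} (s : Similarity n) (st : GHState n) (u v : Fin n)
    (C : Finset (Fin n)) : GHState n where
  node i := if st.node i = st.node u ∧ i ∉ C then v else st.node i
  edges := (st.node u, v, cutValue s C) ::
    st.edges.map (fun e =>
      (if e.1 = st.node u ∧ e.2.1 ∉ C then v else e.1,
       if e.2.1 = st.node u ∧ e.1 ∉ C then v else e.2.1,
       e.2.2))

/-- One step of the Gomory-Hu algorithm, for the lexicographically first pair `u < v` of points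
that lie in the same supernode. -/
def GHState.step {n : ℕ} (s : Similarity n) (st : GHState n) : GHState n :=
  match (lexPairs n).find? (fun p => decide (p.1 < p.2 ∧ st.node p.1 = st.node p.2)) with
  | none => st
  | some p => st.split s p.1 p.2 (st.minCut s p.1 p.2)

/-- The canonical minimum cut tree `MCT(s)`, as the list of its weighted edges: the result of
`n - 1` steps of the Gomory-Hu algorithm, when each supernode is a single point. -/
def mct {n : ℕ} (s : Similarity n) : List (WEdge n) :=
  ((GHState.step s)^[n - 1] (GHState.init n)).edges

/-- Edges are ordered by weight, and lexicographically among edges of equal weight. -/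
def edgeKey {n : ℕ} (e : WEdge n) : ℝ ×ₗ (Fin n ×ₗ Fin n) :=
  toLex (e.2.2, toLex (min e.1 e.2.1, max e.1 e.2.1))

open scoped Classical in
/-- The edges of the tree `T` that remain when its `k - 1` smallest edges are cut: those that are
preceded by at least `k - 1` edges. -/
def keptEdges {n : ℕ} (T : List (WEdge n)) (k : ℕ) : List (WEdge n) :=
  T.filter (fun e => decide (k ≤ T.countP (fun f => decide (edgeKey f < edgeKey e)) + 1))

/-- The graph with the given edges. -/
def edgeGraph {n : ℕ} (L : List (WEdge n)) : SimpleGraph (Fin n) :=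
  SimpleGraph.fromRel (fun a b => ∃ w : ℝ, (a, b, w) ∈ L)

open scoped Classical in
/-- The minimum `k`-cut of the tree `T`, as a partition of the points: the connected components
that are left when the `k - 1` smallest edges of `T` are cut. -/
def minKCut {n : ℕ} (T : List (WEdge n)) (k : ℕ) : Partition n :=
  Finpartition.ofSetoid (edgeGraph (keptEdges T k)).reachableSetoid

/-- MCT-Consistency. -/
def MCTConsistent {n : ℕ} (k : ℕ) (F : Similarity n → Partition n) : Prop :=
  ∀ s s' : Similarity n, minKCut (mct s) k = minKCut (mct s') k → F s = F s'

/-! ### The partitioning functions -/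

/-- Max-Sum: cut the `k - 1` smallest edges of the minimum cut tree. -/
def maxSum {n : ℕ} (k : ℕ) (s : Similarity n) : Partition n := minKCut (mct s) k

/-- The member of the MCT cuts family given by a permutation `σ` of the `k`-partitionings:
Max-Sum followed by `σ`. -/
def mctCuts {n k : ℕ} (σ : Equiv.Perm (KPartition n k)) (s : Similarity n) : Partition n :=
  letI := Classical.decPred (IsKPartition (n := n) k)
  Equiv.Perm.ofSubtype σ (maxSum k s)

open scoped Classical in
/-- One step of Single-Linkage. A clustering is given by labels, `c i` being the label of the
cluster of `i`. The most similar pair of points in different clusters (the lexicographically first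
one, if there are several) is found, and the clusters of its two points are merged. -/
def slStep {n : ℕ} (s : Similarity n) (c : Fin n → Fin n) : Fin n → Fin n :=
  match ((lexPairs n).filter (fun p => decide (p.1 < p.2 ∧ c p.1 ≠ c p.2))).argmax
      (fun p => s.toFun p.1 p.2) with
  | none => c
  | some p => fun i => if c i = c p.2 then c p.1 else c i

open scoped Classical in
/-- Single-Linkage: start with singletons and merge `n - k` times, which leaves `k` clusters. -/
def singleLinkage {n : ℕ} (k : ℕ) (s : Similarity n) : Partition n :=
  Finpartition.ofSetoid (Setoid.ker ((slStep s)^[n - k] id))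

open scoped Classical in
/-- The constant partitioning: the first `n - k + 1` points (`0, …, n - k`) form one cluster, and
the other `k - 1` points are singletons. -/
def constantPartitioning {n : ℕ} (k : ℕ) (_s : Similarity n) : Partition n :=
  Finpartition.ofSetoid (Setoid.ker (fun i : Fin n => max (i : ℕ) (n - k)))

end Clustering

end

/-!
The three parts rest on two facts about Max-Sum. It always returns a `k`-partitioning, because the
Gomory-Hu algorithm builds a tree (`GHState.isTree_split`): in a tree with distinct edges, each of
the `k - 1` cuts adds exactly one component (`isKPartition_minKCut`). And every similarity function
`s` has, for every `k`-partitioning `P`, a `P`-transformation on which Max-Sum returns `P`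
(`exists_transformation_maxSum`).

For the second fact, take a block similarity function, with one large value `M` inside the clusters
of `P` and one tiny value `ε` across them. Two points `u`, `v` of one cluster are equally similar to
every other point, so that `{u}` is a minimum cut between them, and the first one: the algorithm
splits off `u` as a leaf. If `u` and `v` lie in different clusters, the cluster of `u` has not been
cut except for such leaves, so it is a cut in the contracted graph; its value is below `M`, and
a minimum cut cannot separate two points of one cluster. Hence in the final tree each point that
is not the greatest of its cluster is a leaf at the greatest one, by a heavy edge
(`GHState.BlockInvariant`, `mct_blockSimilarity`). That makes `n - k` heavy edges, and the `k - 1`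
other ones are cut. The general theory of minimum cut trees is not needed.

It follows that Max-Sum is the only function that is Consistent, `k`-Rich and MCT-Consistent
(`eq_maxSum`). So a function `F_σ` with `σ ≠ 1` cannot be Consistent, and Single-Linkage cannot be
MCT-Consistent, once it is known to be Consistent, `k`-Rich and different from Max-Sum. Consistency
holds because the merges that Single-Linkage makes span its clusters and are preferred to all pairs
across them, which a transformation preserves (`consistent_singleLinkage`). The two functions
differ when all points are equally similar: Single-Linkage then merges the first two points, while
the minimum cut tree is a star around the last point, and Max-Sum cuts off the first point. The
constant partitioning also joins the first two points, so it misses that value of Max-Sum.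
-/

namespace Clustering

open Finset

/-! ### Partitions and labellings -/

lemma card_image_le_of_factorsThrough {ι α β : Type*} [Fintype ι] [DecidableEq α] [DecidableEq β]
    {f : ι → α} {g : ι → β} (hfg : Function.FactorsThrough g f) :
    (univ.image g).card ≤ (univ.image f).card := by
  rcases isEmpty_or_nonempty ι with h | ⟨⟨i⟩⟩
  · simp [Finset.univ_eq_empty]
  have : Nonempty β := ⟨g i⟩
  obtain ⟨e, rfl⟩ := (Function.factorsThrough_iff g).1 hfg
  rw [← Finset.image_image]
  exact Finset.card_image_le

/-- A coarser labelling with as many labels is not strictly coarser. -/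
lemma eq_of_card_image_eq {ι α β : Type*} [Fintype ι] [DecidableEq α] [DecidableEq β]
    {f : ι → α} {g : ι → β} (hfg : ∀ i j, f i = f j → g i = g j)
    (hcard : (univ.image f).card ≤ (univ.image g).card) {i j : ι} (h : g i = g j) :
    f i = f j := by
  have : Nonempty β := ⟨g i⟩
  obtain ⟨e, he⟩ := (Function.factorsThrough_iff (f := f) g).1 fun a b hab => hfg a b hab
  have himg : (univ.image f).image e = univ.image g := by rw [Finset.image_image, ← he]
  have hinj : Set.InjOn e (univ.image f : Finset α) := by
    rw [← Finset.card_image_iff, himg]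
    exact le_antisymm (himg ▸ Finset.card_image_le) hcard
  refine hinj (by simp) (by simp) ?_
  simpa [he] using h

variable {n : ℕ}

lemma sameCluster_iff_part {P : Partition n} {i j : Fin n} :
    SameCluster P i j ↔ P.part i = P.part j := by
  constructor
  · rintro ⟨B, hB, hi, hj⟩
    rw [P.part_eq_of_mem hB hi, P.part_eq_of_mem hB hj]
  · intro h
    exact ⟨P.part i, P.part_mem.2 (mem_univ i), P.mem_part (mem_univ i),
      h ▸ P.mem_part (mem_univ j)⟩

lemma image_part (P : Partition n) : univ.image P.part = P.parts := by
  ext B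
  simp only [mem_image, mem_univ, true_and]
  constructor
  · rintro ⟨i, rfl⟩
    exact P.part_mem.2 (mem_univ i)
  · intro hB
    obtain ⟨i, hi⟩ := P.nonempty_of_mem_parts hB
    exact ⟨i, P.part_eq_of_mem hB hi⟩

lemma partition_ext {P Q : Partition n} (h : ∀ i j, SameCluster P i j ↔ SameCluster Q i j) :
    P = Q := by
  have hpart : P.part = Q.part := by
    funext i
    ext j
    rw [P.mem_part_iff_part_eq_part (mem_univ _) (mem_univ _),
      Q.mem_part_iff_part_eq_part (mem_univ _) (mem_univ _),
      ← sameCluster_iff_part, ← sameCluster_iff_part, h]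
  ext1
  rw [← image_part, ← image_part, hpart]

/-- A refinement with as many clusters is no refinement. -/
lemma eq_of_refines {P Q : Partition n} (h : ∀ i j, SameCluster P i j → SameCluster Q i j)
    (hcard : P.parts.card ≤ Q.parts.card) : P = Q := by
  refine partition_ext fun i j => ⟨h i j, fun hij => ?_⟩
  rw [sameCluster_iff_part] at hij ⊢
  refine eq_of_card_image_eq (fun a b hab => ?_) (by rwa [image_part, image_part]) hij
  exact sameCluster_iff_part.1 (h a b (sameCluster_iff_part.2 hab))

lemma sameCluster_ofSetoid (r : Setoid (Fin n)) [DecidableRel r] {i j : Fin n} :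
    SameCluster (Finpartition.ofSetoid r) i j ↔ r i j := by
  rw [sameCluster_iff_part, ← Finpartition.mem_part_iff_part_eq_part _ (mem_univ _) (mem_univ _),
    Finpartition.mem_part_ofSetoid_iff_rel]
  exact ⟨fun h => r.symm h, fun h => r.symm h⟩

lemma card_parts_eq_of_label {α : Type*} [DecidableEq α] {P : Partition n} {f : Fin n → α}
    (h : ∀ i j, SameCluster P i j ↔ f i = f j) : P.parts.card = (univ.image f).card := by
  rw [← image_part]
  have h' : ∀ i j, P.part i = P.part j ↔ f i = f j := fun i j => by
    rw [← sameCluster_iff_part, h]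
  exact le_antisymm (card_image_le_of_factorsThrough fun i j hij => (h' i j).2 hij)
    (card_image_le_of_factorsThrough fun i j hij => (h' i j).1 hij)

/-! ### Lexicographic order of pairs -/

lemma mem_lexPairs (p : Fin n × Fin n) : p ∈ lexPairs n := by
  exact List.mem_product.2 ⟨List.mem_finRange _, List.mem_finRange _⟩

lemma pairwise_lexPairs : (lexPairs n).Pairwise (fun p q => toLex p < toLex q) := by
  have : lexPairs n = (List.finRange n).flatMap fun a => (List.finRange n).map (Prod.mk a) := rfl
  rw [this, List.pairwise_flatMap]
  constructor
  · intro a _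
    rw [List.pairwise_map]
    exact (List.pairwise_lt_finRange n).imp fun h => by simp [Prod.Lex.toLex_lt_toLex, h]
  · refine (List.pairwise_lt_finRange n).imp ?_
    intro a b hab p hp q hq
    simp only [List.mem_map] at hp hq
    obtain ⟨_, _, rfl⟩ := hp
    obtain ⟨_, _, rfl⟩ := hq
    simp [Prod.Lex.toLex_lt_toLex, hab]

lemma toLex_le_of_argmax {l : List (Fin n × Fin n)}
    (hl : l.Pairwise (fun p q => toLex p < toLex q)) {f : Fin n × Fin n → ℝ} {p q : Fin n × Fin n}
    (hp : p ∈ l.argmax f) (hq : q ∈ l) (hpq : f q = f p) : toLex p ≤ toLex q := by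
  have hidx : List.idxOf p l ≤ List.idxOf q l := by
    convert List.index_of_argmax hp hq hpq.ge
  have hpl := List.argmax_mem hp
  have h1 := List.idxOf_lt_length_of_mem hpl
  have h2 := List.idxOf_lt_length_of_mem hq
  rcases hidx.lt_or_eq with h | h
  · have := List.pairwise_iff_getElem.1 hl _ _ h1 h2 h
    simpa using this.le
  · rw [List.idxOf_inj hpl] at h
    rw [h]

lemma toLex_le_of_find? {l : List (Fin n × Fin n)}
    (hl : l.Pairwise (fun p q => toLex p < toLex q)) {f : Fin n × Fin n → Bool}
    {p q : Fin n × Fin n} (hp : l.find? f = some p) (hq : q ∈ l) (hfq : f q = true) :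
    toLex p ≤ toLex q := by
  obtain ⟨_, as, bs, rfl, has⟩ := List.find?_eq_some_iff_append.1 hp
  rw [List.mem_append, List.mem_cons] at hq
  rcases hq with hq | rfl | hq
  · simpa [hfq] using has q hq
  · exact le_rfl
  · exact ((List.pairwise_cons.1 (List.pairwise_append.1 hl).2.1).1 q hq).le

/-! ### Single-Linkage -/

/-- Single-Linkage prefers merging the pair `p` to merging the pair `q`: `p` is more similar, or
equally similar and not lexicographically later. -/
def Prefers (s : Similarity n) (p q : Fin n × Fin n) : Prop :=
  s.toFun q.1 q.2 < s.toFun p.1 p.2 ∨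
    (s.toFun q.1 q.2 = s.toFun p.1 p.2 ∧ toLex p ≤ toLex q)

lemma Prefers.antisymm {s : Similarity n} {p q : Fin n × Fin n} (h : Prefers s p q)
    (h' : Prefers s q p) : p = q := by
  rcases h with h | ⟨h, hl⟩ <;> rcases h' with h' | ⟨h', hl'⟩
  · exact absurd h h'.not_gt
  · exact absurd h h'.not_gt
  · exact absurd h' h.not_gt
  · exact toLex.injective (le_antisymm hl hl')

/-- As long as there are two labels, a step of Single-Linkage merges the pair that it prefers to all
others. -/
lemma slStep_spec (s : Similarity n) (c : Fin n → Fin n) (hc : ∃ i j, c i ≠ c j) :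
    ∃ p : Fin n × Fin n, p.1 < p.2 ∧ c p.1 ≠ c p.2 ∧
      (∀ q : Fin n × Fin n, q.1 < q.2 → c q.1 ≠ c q.2 → Prefers s p q) ∧
      slStep s c = fun i => if c i = c p.2 then c p.1 else c i := by
  classical
  set l := (lexPairs n).filter (fun p => decide (p.1 < p.2 ∧ c p.1 ≠ c p.2)) with hl
  have hmem : ∀ q, q ∈ l ↔ q.1 < q.2 ∧ c q.1 ≠ c q.2 := fun q => by
    simp [hl, mem_lexPairs]
  have hsorted : l.Pairwise (fun p q => toLex p < toLex q) := pairwise_lexPairs.filter _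
  cases hm : l.argmax (fun p => s.toFun p.1 p.2) with
  | none =>
    rw [List.argmax_eq_none] at hm
    obtain ⟨i, j, hij⟩ := hc
    rcases lt_trichotomy i j with h | h | h
    · exact absurd ((hmem (i, j)).2 ⟨h, hij⟩) (by simp [hm])
    · exact absurd (congrArg c h) hij
    · exact absurd ((hmem (j, i)).2 ⟨h, hij.symm⟩) (by simp [hm])
  | some p =>
    have hp := (hmem p).1 (List.argmax_mem hm)
    refine ⟨p, hp.1, hp.2, fun q hq hcq => ?_, ?_⟩
    · have hql := (hmem q).2 ⟨hq, hcq⟩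
      rcases (List.le_of_mem_argmax hql hm).lt_or_eq with h | h
      · exact Or.inl h
      · exact Or.inr ⟨h, toLex_le_of_argmax hsorted hm hql h⟩
    · unfold slStep
      split
      · next h =>
          have : none = some p := h.symm.trans (by convert hm)
          cases this
      · next q h =>
          have : some q = some p := h.symm.trans (by convert hm)
          cases this
          rfl

lemma slStep_eq_self_or (s : Similarity n) (c : Fin n → Fin n) :
    slStep s c = c ∨
      ∃ p : Fin n × Fin n, slStep s c = fun i => if c i = c p.2 then c p.1 else c i := by
  unfold slStep
  split
  · exact Or.inl rfl
  · exact Or.inr ⟨_, rfl⟩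

lemma slStep_eq_of_eq (s : Similarity n) {c : Fin n → Fin n} {i j : Fin n} (h : c i = c j) :
    slStep s c i = slStep s c j := by
  rcases slStep_eq_self_or s c with hs | ⟨p, hs⟩
  · rw [hs, h]
  · simp only [hs, h]

lemma exists_ne_of_one_lt_card {c : Fin n → Fin n} (h : 1 < (univ.image c).card) :
    ∃ i j, c i ≠ c j := by
  obtain ⟨a, ha, b, hb, hab⟩ := Finset.one_lt_card.1 h
  simp only [mem_image, mem_univ, true_and] at ha hb
  obtain ⟨i, rfl⟩ := ha
  obtain ⟨j, rfl⟩ := hb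
  exact ⟨i, j, hab⟩

lemma card_image_slStep (s : Similarity n) {c : Fin n → Fin n} (h : 1 < (univ.image c).card) :
    (univ.image (slStep s c)).card + 1 = (univ.image c).card := by
  obtain ⟨p, -, hne, -, hp⟩ := slStep_spec s c (exists_ne_of_one_lt_card h)
  have himg : univ.image (slStep s c) = (univ.image c).erase (c p.2) := by
    ext a
    simp only [hp, mem_image, mem_univ, true_and, mem_erase]
    constructor
    · rintro ⟨i, rfl⟩
      split_ifs with hi
      · exact ⟨hne, _, rfl⟩
      · exact ⟨hi, _, rfl⟩
    · rintro ⟨ha, i, rfl⟩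
      exact ⟨i, if_neg ha⟩
  rw [himg, Finset.card_erase_add_one (by simp)]

lemma card_image_slStep_iterate (s : Similarity n) {j : ℕ} (hj : j < n) :
    (univ.image ((slStep s)^[j] id)).card = n - j := by
  induction j with
  | zero => simp
  | succ j ih =>
    have ih := ih (by omega)
    rw [Function.iterate_succ_apply']
    have := card_image_slStep s (c := (slStep s)^[j] id) (by omega)
    omega

lemma slStep_iterate_eq_of_le (s : Similarity n) {a b : ℕ} (hab : a ≤ b) {i j : Fin n}
    (h : (slStep s)^[a] id i = (slStep s)^[a] id j) :
    (slStep s)^[b] id i = (slStep s)^[b] id j := by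
  induction b, hab using Nat.le_induction with
  | base => exact h
  | succ b _ ih =>
    rw [Function.iterate_succ_apply']
    exact slStep_eq_of_eq s ih

lemma sameCluster_singleLinkage {k : ℕ} {s : Similarity n} {i j : Fin n} :
    SameCluster (singleLinkage k s) i j ↔
      (slStep s)^[n - k] id i = (slStep s)^[n - k] id j := by
  classical
  unfold singleLinkage
  rw [sameCluster_ofSetoid]
  exact Setoid.ker_def

lemma isPartitioningFunction_singleLinkage {k : ℕ} (hk : 1 ≤ k) (hkn : k ≤ n) :
    IsPartitioningFunction k (singleLinkage (n := n) k) := by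
  intro s
  unfold IsKPartition
  rw [card_parts_eq_of_label fun i j => sameCluster_singleLinkage,
    card_image_slStep_iterate s (by omega)]
  omega

lemma slStep_scale (s : Similarity n) {α : ℝ} (hα : 0 < α) (c : Fin n → Fin n) :
    slStep (s.scale α hα) c = slStep s c := by
  by_cases hc : ∃ i j, c i ≠ c j
  · obtain ⟨p, hp, hcp, hpref, heq⟩ := slStep_spec s c hc
    obtain ⟨q, hq, hcq, hqref, heq'⟩ := slStep_spec (s.scale α hα) c hc
    have hqp : Prefers s q p := by
      rcases hqref p hp hcp with h | ⟨h, hl⟩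
      · exact Or.inl (lt_of_mul_lt_mul_left h hα.le)
      · exact Or.inr ⟨mul_left_cancel₀ hα.ne' h, hl⟩
    rw [heq, heq', (hpref q hq hcq).antisymm hqp]
  · push Not at hc
    funext i
    have h (t : Similarity n) : slStep t c i = c i := by
      rcases slStep_eq_self_or t c with ht | ⟨p, ht⟩
      · rw [ht]
      · simp only [ht]
        split_ifs
        · exact hc _ _
        · rfl
    rw [h, h]

lemma scaleInvariant_singleLinkage (k : ℕ) : ScaleInvariant (singleLinkage (n := n) k) := by
  intro s α hα
  have : slStep (s.scale α hα) = slStep s := funext (slStep_scale s hα)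
  unfold singleLinkage
  rw [this]

/-- Single-Linkage returns `P` if, as long as not all clusters of `P` are complete, some pair that
completes one of them is preferred to every pair across `P`. -/
lemma singleLinkage_eq_of_prefers {k : ℕ} (hk : 1 ≤ k) (hkn : k ≤ n) {s : Similarity n}
    {P : Partition n} (hP : IsKPartition k P)
    (h : ∀ c : Fin n → Fin n, (∃ i j, SameCluster P i j ∧ c i ≠ c j) →
      ∃ q : Fin n × Fin n, SameCluster P q.1 q.2 ∧ q.1 < q.2 ∧ c q.1 ≠ c q.2 ∧
        ∀ p : Fin n × Fin n, ¬ SameCluster P p.1 p.2 → p.1 < p.2 → c p.1 ≠ c p.2 →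
          Prefers s q p) :
    singleLinkage k s = P := by
  have key : ∀ j ≤ n - k, ∀ i i', (slStep s)^[j] id i = (slStep s)^[j] id i' →
      SameCluster P i i' := by
    intro j
    induction j with
    | zero =>
      intro _ i i' hii
      exact sameCluster_iff_part.2 (congrArg _ hii)
    | succ j ih =>
      intro hj i i'
      have ih := ih (by omega)
      have hcard := card_image_slStep_iterate s (j := j) (by omega)
      rw [Function.iterate_succ_apply']
      set c := (slStep s)^[j] id with hc
      -- the labelling has more than `k` labels, so it does not yet exhaust `P`
      have hex : ∃ i j, SameCluster P i j ∧ c i ≠ c j := by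
        by_contra! hall
        have hle : (univ.image c).card ≤ (univ.image P.part).card :=
          card_image_le_of_factorsThrough fun a b hab =>
            hall a b (sameCluster_iff_part.2 hab)
        rw [image_part, hP] at hle
        omega
      obtain ⟨q, hPq, hq, hcq, hpref⟩ := h c hex
      obtain ⟨p, hp, hcp, hbest, heq⟩ := slStep_spec s c ⟨_, _, hcq⟩
      have hPp : SameCluster P p.1 p.2 := by
        by_contra hPp
        have := (hbest q hq hcq).antisymm (hpref p hPp hp hcp)
        exact hPp (this ▸ hPq)
      rw [sameCluster_iff_part] at hPp ⊢
      have ih' : ∀ a b, c a = c b → P.part a = P.part b := fun a b hab =>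
        sameCluster_iff_part.1 (ih a b hab)
      have hlab : ∀ a, ∃ b, slStep s c a = c b ∧ P.part b = P.part a := by
        intro a
        simp only [heq]
        split_ifs with ha
        · exact ⟨p.1, rfl, hPp.trans (ih' _ _ ha).symm⟩
        · exact ⟨a, rfl, rfl⟩
      obtain ⟨b, hb, hb'⟩ := hlab i
      obtain ⟨b', hb1, hb1'⟩ := hlab i'
      intro hii
      rw [← hb', ← hb1', ih' b b' (hb.symm.trans (hii.trans hb1))]
  refine eq_of_refines (fun i j hij => key _ le_rfl i j (sameCluster_singleLinkage.1 hij)) ?_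
  rw [isPartitioningFunction_singleLinkage hk hkn s, hP]

lemma SameCluster.refl (P : Partition n) (i : Fin n) : SameCluster P i i :=
  sameCluster_iff_part.2 rfl

lemma SameCluster.symm {P : Partition n} {i j : Fin n} (h : SameCluster P i j) :
    SameCluster P j i :=
  sameCluster_iff_part.2 (sameCluster_iff_part.1 h).symm

lemma exists_lt_of_exists_ne {P : Partition n} {c : Fin n → Fin n}
    (h : ∃ i j, SameCluster P i j ∧ c i ≠ c j) :
    ∃ q : Fin n × Fin n, SameCluster P q.1 q.2 ∧ q.1 < q.2 ∧ c q.1 ≠ c q.2 := by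
  obtain ⟨i, j, hij, hc⟩ := h
  rcases lt_trichotomy i j with hlt | heq | hlt
  · exact ⟨(i, j), hij, hlt, hc⟩
  · exact absurd (congrArg c heq) hc
  · exact ⟨(j, i), hij.symm, hlt, hc.symm⟩

/-- The merges of Single-Linkage on `s` span its clusters, and each of them is preferred to all
pairs across the clusters. A transformation of `s` keeps these preferences. -/
lemma consistent_singleLinkage {k : ℕ} (hk : 1 ≤ k) (hkn : k ≤ n) :
    Consistent (singleLinkage (n := n) k) := by
  intro s s' htr
  set P := singleLinkage k s with hPdef
  refine singleLinkage_eq_of_prefers hk hkn (isPartitioningFunction_singleLinkage hk hkn s) ?_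
  intro c hex
  -- a merge of `s` that `c` has not yet made
  obtain ⟨q, hPq, hq, hcq, hpref⟩ : ∃ q : Fin n × Fin n, SameCluster P q.1 q.2 ∧ q.1 < q.2 ∧
      c q.1 ≠ c q.2 ∧ ∀ p : Fin n × Fin n, ¬ SameCluster P p.1 p.2 → p.1 < p.2 →
        Prefers s q p := by
    by_contra! hno
    have key : ∀ j ≤ n - k, ∀ i i', (slStep s)^[j] id i = (slStep s)^[j] id i' → c i = c i' := by
      intro j
      induction j with
      | zero =>
        intro _ i i' hii
        exact congrArg c hii
      | succ j ih =>
        intro hj i i'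
        have ih := ih (by omega)
        have hcard := card_image_slStep_iterate s (j := j) (by omega)
        obtain ⟨p, hp, hcp, hbest, heq⟩ := slStep_spec s ((slStep s)^[j] id)
          (exists_ne_of_one_lt_card (by omega))
        have hPp : SameCluster P p.1 p.2 := by
          refine sameCluster_singleLinkage.2 (slStep_iterate_eq_of_le s hj ?_)
          rw [Function.iterate_succ_apply', heq]
          simp
        have hcc : c p.1 = c p.2 := by
          by_contra hcc
          obtain ⟨r, hPr, hr, hnot⟩ := hno p hPp hp hcc
          exact hnot (hbest r hr fun hrr =>
            hPr (sameCluster_singleLinkage.2 (slStep_iterate_eq_of_le s (by omega) hrr)))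
        rw [Function.iterate_succ_apply']
        have hlab : ∀ a, ∃ b, slStep s ((slStep s)^[j] id) a = (slStep s)^[j] id b ∧
            c b = c a := by
          intro a
          simp only [heq]
          split_ifs with ha
          · exact ⟨p.1, rfl, hcc.trans (ih _ _ ha).symm⟩
          · exact ⟨a, rfl, rfl⟩
        obtain ⟨b, hb, hb'⟩ := hlab i
        obtain ⟨b', hb1, hb1'⟩ := hlab i'
        intro hii
        rw [← hb', ← hb1', ih b b' (hb.symm.trans (hii.trans hb1))]
    obtain ⟨i, j, hij, hne⟩ := hex
    exact hne (key _ le_rfl i j (sameCluster_singleLinkage.1 hij))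
  refine ⟨q, hPq, hq, hcq, fun p hPp hp _ => ?_⟩
  have h1 := htr.1 _ _ hPq
  have h2 := htr.2 _ _ hPp
  rcases hpref p hPp hp with h | ⟨h, hl⟩
  · exact Or.inl (by linarith)
  · rcases (h2.trans (h.le.trans h1)).lt_or_eq with h' | h'
    · exact Or.inl h'
    · exact Or.inr ⟨h', hl⟩

/-! ### Connected components of edge lists -/

lemma edgeGraph_adj {L : List (WEdge n)} {a b : Fin n} :
    (edgeGraph L).Adj a b ↔ a ≠ b ∧ ∃ e ∈ L, (e.1 = a ∧ e.2.1 = b) ∨ (e.1 = b ∧ e.2.1 = a) := by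
  rw [edgeGraph, SimpleGraph.fromRel_adj]
  refine and_congr_right fun _ => ⟨?_, ?_⟩
  · rintro (⟨w, hw⟩ | ⟨w, hw⟩)
    · exact ⟨_, hw, Or.inl ⟨rfl, rfl⟩⟩
    · exact ⟨_, hw, Or.inr ⟨rfl, rfl⟩⟩
  · rintro ⟨⟨x, y, w⟩, he, ⟨rfl, rfl⟩ | ⟨rfl, rfl⟩⟩
    · exact Or.inl ⟨w, he⟩
    · exact Or.inr ⟨w, he⟩

lemma edgeGraph_reachable_of_mem {L : List (WEdge n)} {e : WEdge n} (he : e ∈ L) :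
    (edgeGraph L).Reachable e.1 e.2.1 := by
  by_cases h : e.1 = e.2.1
  · rw [h]
  · exact (edgeGraph_adj.2 ⟨h, e, he, Or.inl ⟨rfl, rfl⟩⟩).reachable

/-- Reachability in an edge graph is the equivalence relation generated by the edges. -/
lemma rel_of_reachable {L : List (WEdge n)} {r : Fin n → Fin n → Prop} (hr : Equivalence r)
    (h : ∀ e ∈ L, r e.1 e.2.1) {a b : Fin n} (hab : (edgeGraph L).Reachable a b) : r a b := by
  obtain ⟨p⟩ := hab
  induction p with
  | nil => exact hr.refl _
  | cons hadj _ ih =>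
    obtain ⟨-, e, he, ⟨rfl, rfl⟩ | ⟨rfl, rfl⟩⟩ := edgeGraph_adj.1 hadj
    · exact hr.trans (h e he) ih
    · exact hr.trans (hr.symm (h e he)) ih

lemma reachable_equivalence (L : List (WEdge n)) : Equivalence (edgeGraph L).Reachable :=
  (edgeGraph L).reachable_is_equivalence

lemma reachable_mono {L L' : List (WEdge n)} (h : ∀ e ∈ L, (edgeGraph L').Reachable e.1 e.2.1)
    {a b : Fin n} (hab : (edgeGraph L).Reachable a b) : (edgeGraph L').Reachable a b :=
  rel_of_reachable (reachable_equivalence L') h hab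

/-- The number of connected components of the graph with the given edges. -/
noncomputable def numComponents (L : List (WEdge n)) : ℕ :=
  Nat.card (edgeGraph L).ConnectedComponent

lemma numComponents_nil : numComponents ([] : List (WEdge n)) = n := by
  have hinj : Function.Injective (edgeGraph ([] : List (WEdge n))).connectedComponentMk := by
    intro a b hab
    exact rel_of_reachable eq_equivalence (by simp) (SimpleGraph.ConnectedComponent.exact hab)
  have := Nat.card_congr (Equiv.ofBijective _ ⟨hinj, Quot.mk_surjective⟩)
  rw [numComponents, ← this, Nat.card_eq_fintype_card, Fintype.card_fin]

lemma numComponents_le_of_forall {L L' : List (WEdge n)}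
    (h : ∀ e ∈ L, (edgeGraph L').Reachable e.1 e.2.1) : numComponents L' ≤ numComponents L := by
  refine Nat.card_le_card_of_surjective
    (Quot.map id fun a b hab => reachable_mono h hab) fun c => ?_
  induction c using Quot.ind with
  | _ a => exact ⟨Quot.mk _ a, rfl⟩

/-- Adding an edge joins at most two components. -/
lemma numComponents_le_cons (e : WEdge n) (L : List (WEdge n)) :
    numComponents L ≤ numComponents (e :: L) + 1 := by
  classical
  let G := edgeGraph L
  let φ : G.ConnectedComponent → (edgeGraph (e :: L)).ConnectedComponent :=
    Quot.map id fun a b hab =>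
      reachable_mono (fun f hf => edgeGraph_reachable_of_mem (List.mem_cons_of_mem _ hf)) hab
  let ψ : G.ConnectedComponent → Option (edgeGraph (e :: L)).ConnectedComponent :=
    fun c => if c = G.connectedComponentMk e.1 then none else some (φ c)
  -- `r` joins the classes of the two ends of `e`
  let r : Fin n → Fin n → Prop := fun a b =>
    G.Reachable a b ∨ (G.Reachable a e.1 ∧ G.Reachable e.2.1 b) ∨
      (G.Reachable a e.2.1 ∧ G.Reachable e.1 b)
  have hr : Equivalence r := by
    refine ⟨fun a => Or.inl (.refl a), fun {a b} hab => ?_, fun {a b c} hab hbc => ?_⟩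
    · rcases hab with h | ⟨h, h'⟩ | ⟨h, h'⟩
      · exact Or.inl h.symm
      · exact Or.inr (Or.inr ⟨h'.symm, h.symm⟩)
      · exact Or.inr (Or.inl ⟨h'.symm, h.symm⟩)
    · rcases hab with h | ⟨h, h'⟩ | ⟨h, h'⟩ <;> rcases hbc with g | ⟨g, g'⟩ | ⟨g, g'⟩
      · exact Or.inl (h.trans g)
      · exact Or.inr (Or.inl ⟨h.trans g, g'⟩)
      · exact Or.inr (Or.inr ⟨h.trans g, g'⟩)
      · exact Or.inr (Or.inl ⟨h, h'.trans g⟩)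
      · exact Or.inr (Or.inl ⟨h, g'⟩)
      · exact Or.inl (h.trans g')
      · exact Or.inr (Or.inr ⟨h, h'.trans g⟩)
      · exact Or.inl (h.trans g')
      · exact Or.inr (Or.inr ⟨h, g'⟩)
  have hψ : Function.Injective ψ := by
    intro c d
    induction c using SimpleGraph.ConnectedComponent.ind with | _ a
    induction d using SimpleGraph.ConnectedComponent.ind with | _ b
    intro h
    simp only [ψ] at h
    split_ifs at h with ha hb hb
    · rw [ha, hb]
    · have hab : r a b := by
        refine rel_of_reachable hr (fun f hf => ?_)
          (SimpleGraph.ConnectedComponent.exact (Option.some.inj h))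
        rcases List.mem_cons.1 hf with rfl | hf
        · exact Or.inr (Or.inl ⟨.refl _, .refl _⟩)
        · exact Or.inl (edgeGraph_reachable_of_mem hf)
      rcases hab with h | ⟨h, -⟩ | ⟨-, h⟩
      · exact SimpleGraph.ConnectedComponent.sound h
      · exact absurd (SimpleGraph.ConnectedComponent.sound h) ha
      · exact absurd (SimpleGraph.ConnectedComponent.sound h.symm) hb
  have := Nat.card_le_card_of_injective ψ hψ
  rwa [Finite.card_option] at this

lemma numComponents_le_append (L L' : List (WEdge n)) :
    numComponents L' ≤ numComponents (L ++ L') + L.length := by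
  induction L with
  | nil => simp
  | cons e L ih =>
    have := numComponents_le_cons e (L ++ L')
    simp only [List.cons_append, List.length_cons]
    omega

lemma le_numComponents_add_length (L : List (WEdge n)) : n ≤ numComponents L + L.length := by
  simpa [numComponents_nil] using numComponents_le_append L []

/-- A forest has no two edges between the same points. -/
lemma nodup_keys_of_forest {L : List (WEdge n)} (h : numComponents L + L.length ≤ n) :
    (L.map edgeKey).Nodup := by
  induction L with
  | nil => simp
  | cons e L ih =>
    have h1 := numComponents_le_cons e L
    have h2 := le_numComponents_add_length L
    rw [List.length_cons] at h
    rw [List.map_cons, List.nodup_cons]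
    refine ⟨fun hmem => ?_, ih (by omega)⟩
    obtain ⟨f, hf, hfe⟩ := List.mem_map.1 hmem
    have hends : (f.1 = e.1 ∧ f.2.1 = e.2.1) ∨ (f.1 = e.2.1 ∧ f.2.1 = e.1) := by
      simp only [edgeKey, EmbeddingLike.apply_eq_iff_eq, Prod.mk.injEq] at hfe
      obtain ⟨-, h1, h2⟩ := hfe
      rcases le_total f.1 f.2.1 with hf' | hf' <;> rcases le_total e.1 e.2.1 with he' | he' <;>
        simp only [min_eq_left, min_eq_right, max_eq_left, max_eq_right, hf', he'] at h1 h2 <;>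
        tauto
    have hle : numComponents L ≤ numComponents (e :: L) := by
      refine numComponents_le_of_forall fun g hg => ?_
      rcases List.mem_cons.1 hg with rfl | hg
      · rcases hends with ⟨h1, h2⟩ | ⟨h1, h2⟩
        · exact h1 ▸ h2 ▸ edgeGraph_reachable_of_mem hf
        · exact h1 ▸ h2 ▸ (edgeGraph_reachable_of_mem hf).symm
      · exact edgeGraph_reachable_of_mem hg
    omega

/-! ### Cutting the smallest edges -/

/-- All but `m` elements of a finite linear order are preceded by at least `m` elements. -/
lemma card_filter_le_card_lt {α : Type*} [LinearOrder α] (K : Finset α) (m : ℕ) :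
    (K.filter fun x => m ≤ (K.filter (· < x)).card).card = K.card - m := by
  set rk : α → ℕ := fun x => (K.filter (· < x)).card
  have hlt : ∀ x ∈ K, ∀ y, x < y → rk x < rk y := by
    intro x hx y hxy
    refine Finset.card_lt_card ⟨fun z hz => ?_, fun hsub => ?_⟩
    · rw [mem_filter] at hz ⊢
      exact ⟨hz.1, hz.2.trans hxy⟩
    · exact lt_irrefl x (mem_filter.1 (hsub (mem_filter.2 ⟨hx, hxy⟩))).2
  have hinj : Set.InjOn rk K := by
    intro x hx y hy hxy
    rcases lt_trichotomy x y with h | h | h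
    · exact absurd hxy (hlt x hx y h).ne
    · exact h
    · exact absurd hxy (hlt y hy x h).ne'
  have himg : K.image rk = range K.card := by
    refine Finset.eq_of_subset_of_card_le (fun a ha => ?_) ?_
    · obtain ⟨x, hx, rfl⟩ := mem_image.1 ha
      exact mem_range.2 (Finset.card_lt_card
        ⟨filter_subset _ _, fun hsub => lt_irrefl x (mem_filter.1 (hsub hx)).2⟩)
    · rw [Finset.card_image_of_injOn hinj, card_range]
  have h1 : (K.filter fun x => m ≤ rk x).image rk = (range K.card).filter (m ≤ ·) := by
    rw [← himg, Finset.filter_image]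
  have h2 : (range K.card).filter (m ≤ ·) = Finset.Ico m K.card := by
    ext; simp [and_comm]
  rw [← Finset.card_image_of_injOn (f := rk) (hinj.mono fun x hx => (mem_filter.1 hx).1),
    h1, h2, Nat.card_Ico]

lemma length_keptEdges {T : List (WEdge n)} (hT : (T.map edgeKey).Nodup) {k : ℕ} (hk : 1 ≤ k) :
    (keptEdges T k).length = T.length - (k - 1) := by
  classical
  set K := (T.map edgeKey).toFinset
  have hfilter (p : ℝ ×ₗ (Fin n ×ₗ Fin n) → Prop) [DecidablePred p] :
      (K.filter p).card = (T.filter fun f => decide (p (edgeKey f))).length := by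
    have : K.filter p = ((T.map edgeKey).filter fun x => decide (p x)).toFinset := by
      ext
      simp [K]
    rw [this, List.toFinset_card_of_nodup (hT.filter _), List.filter_map, List.length_map]
    rfl
  have hKcard : K.card = T.length := by
    rw [List.toFinset_card_of_nodup hT, List.length_map]
  rw [← hKcard, ← card_filter_le_card_lt, hfilter, keptEdges]
  congr 1
  refine List.filter_congr fun e _ => ?_
  rw [hfilter, List.countP_eq_length_filter, decide_eq_decide]
  omega

lemma card_parts_ofSetoid_reachable (L : List (WEdge n))
    [DecidableRel (edgeGraph L).reachableSetoid] :
    (Finpartition.ofSetoid (edgeGraph L).reachableSetoid).parts.card = numComponents L := by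
  classical
  rw [card_parts_eq_of_label (f := (edgeGraph L).connectedComponentMk), numComponents,
    Nat.card_eq_fintype_card, ← Finset.card_univ]
  · congr 1
    exact Finset.image_univ_of_surjective Quot.mk_surjective
  · intro i j
    rw [sameCluster_ofSetoid]
    exact SimpleGraph.ConnectedComponent.eq.symm

lemma sameCluster_minKCut {T : List (WEdge n)} {k : ℕ} {i j : Fin n} :
    SameCluster (minKCut T k) i j ↔ (edgeGraph (keptEdges T k)).Reachable i j := by
  unfold minKCut
  rw [sameCluster_ofSetoid]
  rfl

/-- Each of the `k - 1` cuts in a tree adds one component. -/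
lemma isKPartition_minKCut {T : List (WEdge n)} (hlen : T.length + 1 = n)
    (hconn : numComponents T ≤ 1) {k : ℕ} (hk : 1 ≤ k) (hkn : k ≤ n) :
    IsKPartition k (minKCut T k) := by
  classical
  have hkept := length_keptEdges (nodup_keys_of_forest (L := T) (by omega)) hk
  unfold IsKPartition minKCut
  rw [card_parts_ofSetoid_reachable]
  have h1 := le_numComponents_add_length (keptEdges T k)
  set D := T.filter (fun e => !decide (k ≤ T.countP (fun f => decide (edgeKey f < edgeKey e)) + 1))
    with hD
  have hDlen : (keptEdges T k).length + D.length = T.length := by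
    rw [keptEdges, hD]
    exact (List.length_eq_length_filter_add _).symm
  have h2 := numComponents_le_append D (keptEdges T k)
  have h3 : numComponents (D ++ keptEdges T k) ≤ numComponents T := by
    refine numComponents_le_of_forall fun e he => edgeGraph_reachable_of_mem ?_
    rw [List.mem_append, hD, keptEdges, List.mem_filter, List.mem_filter]
    by_cases hke : k ≤ T.countP (fun f => decide (edgeKey f < edgeKey e)) + 1 <;> simp [he, hke]
  omega

/-! ### The Gomory-Hu algorithm builds a tree -/

namespace GHState

/-- The edges of the state form a tree on the names of the supernodes, and each supernode is named
by its least point. A tree is encoded as a connected graph with one edge less than vertices. -/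
structure IsTree (st : GHState n) : Prop where
  node_node : ∀ i, st.node (st.node i) = st.node i
  node_le : ∀ i, st.node i ≤ i
  fst_mem : ∀ e ∈ st.edges, st.node e.1 = e.1
  snd_mem : ∀ e ∈ st.edges, st.node e.2.1 = e.2.1
  ne : ∀ e ∈ st.edges, e.1 ≠ e.2.1
  connected : ∀ i j, (edgeGraph st.edges).Reachable (st.node i) (st.node j)
  length : st.edges.length + 1 = (univ.filter fun i => st.node i = i).card

/-- `u` and `v` are the two least points of one supernode, which is named `u`. The
lexicographically first pair in one supernode is of this form. -/
structure IsFirstPair (st : GHState n) (u v : Fin n) : Prop where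
  lt : u < v
  node_left : st.node u = u
  node_right : st.node v = u
  le : ∀ i, st.node i = u → i ≠ u → v ≤ i

lemma isTree_init (hn : 0 < n) : (init n).IsTree where
  node_node _ := rfl
  node_le i := Fin.mk_le_of_le_val (Nat.zero_le _)
  fst_mem := by simp [init]
  snd_mem := by simp [init]
  ne := by simp [init]
  connected i j := .refl _
  length := by
    rw [Finset.card_eq_one.2 ⟨⟨0, hn⟩, _⟩]
    · simp [init]
    · ext i
      simp [init, eq_comm]

/-- The end that the edge from `a` to `b` has, in place of `a`, after the supernode `u` is split. -/
def reattach (u v : Fin n) (C : Finset (Fin n)) (a b : Fin n) : Fin n :=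
  if a = u ∧ b ∉ C then v else a

variable {s : Similarity n} {st : GHState n} {u v : Fin n} {C : Finset (Fin n)}

lemma IsFirstPair.split_edges (h : st.IsFirstPair u v) (s : Similarity n) (C : Finset (Fin n)) :
    (st.split s u v C).edges = (u, v, cutValue s C) :: st.edges.map fun e =>
      (reattach u v C e.1 e.2.1, reattach u v C e.2.1 e.1, e.2.2) := by
  simp only [split, h.node_left, reattach]

lemma IsFirstPair.split_node (h : st.IsFirstPair u v) (s : Similarity n) (C : Finset (Fin n))
    (i : Fin n) :
    (st.split s u v C).node i = if st.node i = u ∧ i ∉ C then v else st.node i := by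
  simp only [split, h.node_left]

lemma isTree_split (ht : st.IsTree) (h : st.IsFirstPair u v) (hu : u ∈ C) (hv : v ∉ C) :
    (st.split s u v C).IsTree := by
  have hvu : v ≠ u := h.lt.ne'
  have hname : ∀ a, st.node a = a → (st.split s u v C).node a = a := by
    intro a ha
    rw [h.split_node, if_neg, ha]
    rintro ⟨h1, h2⟩
    exact h2 (by rwa [← ha, h1])
  have hvname : (st.split s u v C).node v = v := by
    rw [h.split_node, if_pos ⟨h.node_right, hv⟩]
  have hnv : ∀ a, st.node a = a → a ≠ v := by
    rintro a ha rfl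
    exact hvu (ha.symm.trans h.node_right)
  have hre : ∀ a b, st.node a = a → (st.split s u v C).node (reattach u v C a b) =
      reattach u v C a b := by
    intro a b ha
    unfold reattach
    split_ifs
    · exact hvname
    · exact hname a ha
  have hnode : ∀ i, (st.split s u v C).node i = v ∨ (st.split s u v C).node i = st.node i := by
    intro i
    rw [h.split_node]
    split_ifs <;> simp
  constructor
  · intro i
    rcases hnode i with hi | hi <;> rw [hi]
    · exact hvname
    · exact hname _ (ht.node_node i)
  · intro i
    rw [h.split_node]
    split_ifs with hi
    · exact h.le i hi.1 fun hiu => hi.2 (hiu ▸ hu)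
    · exact ht.node_le i
  · rw [h.split_edges]
    intro e he
    rcases List.mem_cons.1 he with rfl | he
    · exact hname u h.node_left
    · obtain ⟨f, hf, rfl⟩ := List.mem_map.1 he
      exact hre _ _ (ht.fst_mem f hf)
  · rw [h.split_edges]
    intro e he
    rcases List.mem_cons.1 he with rfl | he
    · exact hvname
    · obtain ⟨f, hf, rfl⟩ := List.mem_map.1 he
      exact hre _ _ (ht.snd_mem f hf)
  · rw [h.split_edges]
    intro e he
    rcases List.mem_cons.1 he with rfl | he
    · exact hvu.symm
    · obtain ⟨f, hf, rfl⟩ := List.mem_map.1 he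
      have h1 := ht.ne f hf
      have h2 := hnv _ (ht.fst_mem f hf)
      have h3 := hnv _ (ht.snd_mem f hf)
      simp only [reattach]
      split_ifs with h4 h5 h5
      · exact absurd (h4.1.trans h5.1.symm) h1
      · exact h3.symm
      · exact h2
      · exact h1
  · -- an old edge at `u` that moves to `v` is replaced by a path through the new edge
    have huv : (edgeGraph (st.split s u v C).edges).Reachable u v := by
      rw [h.split_edges]
      exact edgeGraph_reachable_of_mem (e := (u, v, cutValue s C)) List.mem_cons_self
    have hre' : ∀ a b, (edgeGraph (st.split s u v C).edges).Reachable a (reattach u v C a b) := by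
      intro a b
      unfold reattach
      split_ifs with hab
      · rw [hab.1]
        exact huv
      · exact .refl _
    have hold : ∀ a b, (edgeGraph st.edges).Reachable a b →
        (edgeGraph (st.split s u v C).edges).Reachable a b := by
      intro a b
      refine reachable_mono fun e he => ?_
      refine (hre' e.1 e.2.1).trans (.trans ?_ (hre' e.2.1 e.1).symm)
      refine edgeGraph_reachable_of_mem
        (e := (reattach u v C e.1 e.2.1, reattach u v C e.2.1 e.1, e.2.2)) ?_
      rw [h.split_edges]
      exact List.mem_cons_of_mem _ (List.mem_map_of_mem he)
    have hroot : ∀ i, (edgeGraph (st.split s u v C).edges).Reachable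
        ((st.split s u v C).node i) u := by
      intro i
      rcases hnode i with hi | hi <;> rw [hi]
      · exact huv.symm
      · exact hold _ _ (h.node_left ▸ ht.connected i u)
    exact fun i j => (hroot i).trans (hroot j).symm
  · have hfix : (univ.filter fun i => (st.split s u v C).node i = i) =
        insert v (univ.filter fun i => st.node i = i) := by
      ext i
      simp only [mem_filter, mem_univ, true_and, mem_insert]
      constructor
      · intro hi
        rcases hnode i with h' | h'
        · exact Or.inl (hi.symm.trans h')
        · exact Or.inr (h'.symm.trans hi)
      · rintro (rfl | hi)
        · exact hvname
        · exact hname i hi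
    rw [hfix, Finset.card_insert_of_notMem, ← ht.length, h.split_edges]
    · simp
    · simp [h.node_right, hvu.symm]

lemma isContractedCut_singleton (h : st.IsFirstPair u v) :
    st.IsContractedCut u v {u} := by
  refine ⟨by simp, by simpa using h.lt.ne', fun i hi => ?_, fun e _ h1 h2 => ?_⟩
  · rw [h.node_left] at hi
    have : i ≠ u := by
      rintro rfl
      exact hi h.node_left
    simp [hi, this]
  · rw [h.node_left] at h1 h2
    simp [h1, h2]

lemma isMinCut_minCut (s : Similarity n) (h : st.IsFirstPair u v) :
    st.IsMinCut s u v (st.minCut s u v) := by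
  classical
  have hne : ((univ.filter (st.IsMinCut s u v)).image toColex).Nonempty := by
    obtain ⟨D, hD, hmin⟩ := Finset.exists_min_image (univ.filter (st.IsContractedCut u v))
      (cutValue s) ⟨{u}, by simpa using isContractedCut_singleton h⟩
    refine ⟨toColex D, mem_image_of_mem _ ?_⟩
    simp only [mem_filter, mem_univ, true_and] at hD hmin ⊢
    exact ⟨hD, hmin⟩
  have hmem := Finset.min'_mem _ hne
  obtain ⟨D, hD, hD'⟩ := mem_image.1 hmem
  have : st.minCut s u v = D := by
    unfold minCut
    rw [dif_pos (by convert hne)]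
    apply toColex.injective
    rw [hD']
    simp only [toColex_ofColex]
  rw [this]
  simpa using hD

/-- `{u}` is the first minimum cut as soon as it is a minimum cut. -/
lemma minCut_eq_singleton (h : st.IsFirstPair u v)
    (hmin : ∀ C : Finset (Fin n), u ∈ C → v ∉ C → cutValue s {u} ≤ cutValue s C) :
    st.minCut s u v = {u} := by
  classical
  have hu : st.IsMinCut s u v {u} :=
    ⟨isContractedCut_singleton h, fun D hD => hmin D hD.1 hD.2.1⟩
  have hne : ((univ.filter (st.IsMinCut s u v)).image toColex).Nonempty :=
    ⟨toColex {u}, mem_image_of_mem _ (by simpa using hu)⟩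
  have hmin' : ((univ.filter (st.IsMinCut s u v)).image toColex).min' hne = toColex {u} := by
    refine le_antisymm (Finset.min'_le _ _ (mem_image_of_mem _ (by simpa using hu))) ?_
    refine Finset.le_min' _ _ _ fun D' hD' => ?_
    obtain ⟨D, hD, rfl⟩ := mem_image.1 hD'
    rw [mem_filter] at hD
    exact Finset.Colex.toColex_mono (singleton_subset_iff.2 hD.2.1.1)
  unfold minCut
  rw [dif_pos (by convert hne)]
  apply toColex.injective
  rw [toColex_ofColex, ← hmin']

lemma step_eq (s : Similarity n) (ht : st.IsTree) :
    ((∀ i, st.node i = i) ∧ st.step s = st) ∨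
      ∃ u v, st.IsFirstPair u v ∧ st.step s = st.split s u v (st.minCut s u v) := by
  unfold step
  split
  · next hnone =>
    rw [List.find?_eq_none] at hnone
    refine Or.inl ⟨fun i => ?_, rfl⟩
    by_contra hi
    have := hnone (st.node i, i) (mem_lexPairs _)
    simp only [decide_eq_true_eq, not_and] at this
    exact this (lt_of_le_of_ne (ht.node_le i) hi) (ht.node_node i)
  · next p hsome =>
    have hp : p.1 < p.2 ∧ st.node p.1 = st.node p.2 := by
      simpa using List.find?_some hsome
    have hfirst : ∀ i j, i < j → st.node i = st.node j → toLex p ≤ toLex (i, j) := by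
      intro i j hij hnode
      exact toLex_le_of_find? pairwise_lexPairs hsome (mem_lexPairs _) (by simp [hij, hnode])
    have hu : st.node p.1 = p.1 := by
      have hlt : st.node p.1 < p.2 := (ht.node_le _).trans_lt hp.1
      have := hfirst (st.node p.1) p.2 hlt (by rw [ht.node_node, hp.2])
      refine le_antisymm (ht.node_le _) ?_
      rcases Prod.Lex.toLex_le_toLex.1 this with h | ⟨h, -⟩
      · exact h.le
      · exact h.le
    refine Or.inr ⟨p.1, p.2, ⟨hp.1, hu, by rw [← hp.2, hu], fun i hi hiu => ?_⟩, rfl⟩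
    have hlt : p.1 < i := lt_of_le_of_ne (hi ▸ ht.node_le i) hiu.symm
    rcases Prod.Lex.toLex_le_toLex.1 (hfirst p.1 i hlt (by rw [hu, hi])) with h | ⟨-, h⟩
    · exact absurd h (lt_irrefl _)
    · exact h

/-- Induction principle: an invariant of the splits along minimum cuts holds at the end of the
algorithm, when each supernode is a single point. -/
lemma exists_final (hn : 0 < n) (s : Similarity n) (I : GHState n → Prop) (hinit : I (init n))
    (hsplit : ∀ st u v, IsTree st → IsFirstPair st u v → I st →
      I (st.split s u v (st.minCut s u v))) :
    ∃ st : GHState n, st.edges = mct s ∧ IsTree st ∧ (∀ i, st.node i = i) ∧ I st := by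
  have key : ∀ j, IsTree ((GHState.step s)^[j] (init n)) ∧ I ((GHState.step s)^[j] (init n)) ∧
      (min (j + 1) n ≤ (univ.filter fun i => ((GHState.step s)^[j] (init n)).node i = i).card) := by
    intro j
    induction j with
    | zero =>
      refine ⟨isTree_init hn, hinit, ?_⟩
      rw [Function.iterate_zero_apply, ← (isTree_init hn).length]
      simp
    | succ j ih =>
      obtain ⟨ht, hI, hcard⟩ := ih
      rw [Function.iterate_succ_apply']
      set st := (GHState.step s)^[j] (init n)
      rcases step_eq s ht with ⟨hid, hst⟩ | ⟨u, v, h, hst⟩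
      · rw [hst]
        refine ⟨ht, hI, ?_⟩
        simp [hid]
      · have hcut := isMinCut_minCut s h
        have ht' := isTree_split (s := s) ht h hcut.1.1 hcut.1.2.1
        rw [hst]
        refine ⟨ht', hsplit st u v ht h hI, ?_⟩
        rw [← ht'.length, h.split_edges, List.length_cons, List.length_map, ht.length]
        omega
  obtain ⟨ht, hI, hcard⟩ := key (n - 1)
  refine ⟨_, rfl, ht, fun i => ?_, hI⟩
  have huniv := Finset.eq_univ_of_card (univ.filter fun i =>
    ((GHState.step s)^[n - 1] (init n)).node i = i) (by
      refine le_antisymm (Finset.card_le_univ _) ?_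
      rw [Fintype.card_fin]
      omega)
  have := mem_univ i
  rw [← huniv, mem_filter] at this
  exact this.2

end GHState

lemma mct_tree (hn : 0 < n) (s : Similarity n) :
    (mct s).length + 1 = n ∧ (∀ i j, (edgeGraph (mct s)).Reachable i j) ∧
      ∀ e ∈ mct s, e.1 ≠ e.2.1 := by
  obtain ⟨st, hst, ht, hid, -⟩ := GHState.exists_final hn s (fun _ => True) trivial
    fun _ _ _ _ _ _ => trivial
  rw [← hst]
  refine ⟨?_, fun i j => ?_, ht.ne⟩
  · rw [ht.length]
    simp [hid]
  · simpa [hid] using ht.connected i j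

lemma isPartitioningFunction_maxSum {k : ℕ} (hk : 1 ≤ k) (hkn : k ≤ n) :
    IsPartitioningFunction k (maxSum (n := n) k) := by
  intro s
  obtain ⟨hlen, hconn, -⟩ := mct_tree (by omega) s
  refine isKPartition_minKCut hlen ?_ hk hkn
  have : Subsingleton (edgeGraph (mct s)).ConnectedComponent :=
    SimpleGraph.Preconnected.subsingleton_connectedComponent hconn
  exact Finite.card_le_one_iff_subsingleton.2 this

/-! ### Scaling -/

/-- The edge `e` with its weight multiplied by `α`. -/
def scaleEdge (α : ℝ) (e : WEdge n) : WEdge n := (e.1, e.2.1, α * e.2.2)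

/-- The state `st` with the weights of its edges multiplied by `α`. -/
def GHState.scale (α : ℝ) (st : GHState n) : GHState n where
  node := st.node
  edges := st.edges.map (scaleEdge α)

section Scale

variable {α : ℝ} (hα : 0 < α) (s : Similarity n)

lemma cutValue_scale (C : Finset (Fin n)) :
    cutValue (s.scale α hα) C = α * cutValue s C := by
  simp only [cutValue, Similarity.scale, Finset.mul_sum]

lemma GHState.isContractedCut_scale {st : GHState n} {u v : Fin n} {C : Finset (Fin n)} :
    (st.scale α).IsContractedCut u v C ↔ st.IsContractedCut u v C := by
  simp only [IsContractedCut, scale, scaleEdge, List.forall_mem_map]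

lemma GHState.minCut_scale (st : GHState n) (u v : Fin n) :
    (st.scale α).minCut (s.scale α hα) u v = st.minCut s u v := by
  have h : (st.scale α).IsMinCut (s.scale α hα) u v = st.IsMinCut s u v := by
    funext C
    simp only [IsMinCut, isContractedCut_scale, cutValue_scale, mul_le_mul_iff_right₀ hα]
  unfold minCut
  rw [h]

lemma GHState.step_scale (st : GHState n) :
    (st.scale α).step (s.scale α hα) = (st.step s).scale α := by
  unfold step
  have hnode : (st.scale α).node = st.node := rfl
  rw [hnode]
  split
  · rfl
  · next p _ =>
    rw [minCut_scale]
    simp only [split, scale, scaleEdge, cutValue_scale, List.map_cons, List.map_map,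
      Function.comp_def]
    rfl

lemma mct_scale : mct (s.scale α hα) = (mct s).map (scaleEdge α) := by
  have h : ∀ j, (GHState.step (s.scale α hα))^[j] (GHState.init n) =
      ((GHState.step s)^[j] (GHState.init n)).scale α := by
    intro j
    induction j with
    | zero => rfl
    | succ j ih => rw [Function.iterate_succ_apply', Function.iterate_succ_apply', ih,
        GHState.step_scale]
  unfold mct
  rw [h]
  rfl

end Scale

lemma edgeKey_scale_lt {α : ℝ} (hα : 0 < α) {e f : WEdge n} :
    edgeKey (scaleEdge α e) < edgeKey (scaleEdge α f) ↔ edgeKey e < edgeKey f := by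
  simp only [edgeKey, scaleEdge, Prod.Lex.toLex_lt_toLex, mul_lt_mul_iff_right₀ hα,
    mul_right_inj' hα.ne']

lemma keptEdges_scale {α : ℝ} (hα : 0 < α) (T : List (WEdge n)) (k : ℕ) :
    keptEdges (T.map (scaleEdge α)) k = (keptEdges T k).map (scaleEdge α) := by
  unfold keptEdges
  rw [List.filter_map]
  congr 1
  refine List.filter_congr fun e _ => ?_
  simp only [Function.comp_apply, List.countP_map, Function.comp_def, edgeKey_scale_lt hα]

lemma edgeGraph_scale (α : ℝ) (L : List (WEdge n)) :
    edgeGraph (L.map (scaleEdge α)) = edgeGraph L := by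
  ext a b
  simp [edgeGraph_adj, scaleEdge]

lemma scaleInvariant_maxSum (k : ℕ) : ScaleInvariant (maxSum (n := n) k) := by
  intro s α hα
  refine partition_ext fun i j => ?_
  unfold maxSum
  rw [sameCluster_minKCut, sameCluster_minKCut, mct_scale, keptEdges_scale hα, edgeGraph_scale]

/-! ### Block similarity functions -/

/-- The similarity function with the value `M` inside the blocks of a labelling `ρ` and the value
`ε` across them. -/
def blockSimilarity (ρ : Fin n → Fin n) {M ε : ℝ} (hM : 0 < M) (hε : 0 < ε) : Similarity n where
  toFun i j := if ρ i = ρ j then M else ε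
  symm i j := by simp only [eq_comm]
  nonneg i j := by split_ifs <;> positivity
  pos i j _ := by split_ifs <;> positivity

lemma le_cutValue (s : Similarity n) {C : Finset (Fin n)} {i j : Fin n} (hi : i ∈ C) (hj : j ∉ C) :
    s.toFun i j ≤ cutValue s C := by
  refine le_trans ?_ (Finset.single_le_sum (f := fun i => ∑ j ∈ Cᶜ, s.toFun i j)
    (fun a _ => Finset.sum_nonneg fun b _ => s.nonneg a b) hi)
  exact Finset.single_le_sum (f := fun j => s.toFun i j) (fun b _ => s.nonneg i b)
    (mem_compl.2 hj)

/-- If `u` and `v` are equally similar to each other point, no cut between them has a smaller value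
than `{u}`: for every other point `j`, either `u j` or `j v` crosses it. -/
lemma cutValue_singleton_le (s : Similarity n) {u v : Fin n}
    (huv : ∀ j, j ≠ u → j ≠ v → s.toFun u j = s.toFun j v) {C : Finset (Fin n)} (hu : u ∈ C)
    (hv : v ∉ C) : cutValue s {u} ≤ cutValue s C := by
  have hsplit : ({u}ᶜ : Finset (Fin n)) = Cᶜ ∪ C.erase u := by
    ext j
    by_cases hj : j = u <;> by_cases hjC : j ∈ C <;> simp_all
  have hdisj : Disjoint Cᶜ (C.erase u) := by
    rw [Finset.disjoint_left]
    intro j hj hj'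
    exact (mem_compl.1 hj) (mem_of_mem_erase hj')
  have h1 : cutValue s {u} = ∑ j ∈ Cᶜ, s.toFun u j + ∑ j ∈ C.erase u, s.toFun u j := by
    rw [cutValue, Finset.sum_singleton, hsplit, Finset.sum_union hdisj]
  have h2 : cutValue s C = ∑ j ∈ Cᶜ, s.toFun u j + ∑ i ∈ C.erase u, ∑ j ∈ Cᶜ, s.toFun i j := by
    rw [cutValue, Finset.add_sum_erase C (fun i => ∑ j ∈ Cᶜ, s.toFun i j) hu]
  rw [h1, h2]
  gcongr with i hi
  rw [huv i (ne_of_mem_erase hi) fun h => hv (h ▸ mem_of_mem_erase hi)]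
  exact Finset.single_le_sum (f := fun j => s.toFun i j) (fun b _ => s.nonneg i b)
    (mem_compl.2 hv)

/-- The labelling `ρ` names each block by its greatest point. -/
structure IsMaxLabelling (ρ : Fin n → Fin n) : Prop where
  idem : ∀ i, ρ (ρ i) = ρ i
  le : ∀ i, i ≤ ρ i

namespace GHState

/-- What the Gomory-Hu algorithm maintains on a block similarity function. A point `i` either lies
in the supernode of the greatest point `ρ i` of its block, or forms a supernode by itself, each of
whose edges goes to the supernode of `ρ i` and has the value of the cut `{i}` as its weight. All
other edges are lighter than `M`. -/
structure BlockInvariant (s : Similarity n) (ρ : Fin n → Fin n) (M : ℝ) (st : GHState n) :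
    Prop where
  singleton : ∀ i, st.node i ≠ st.node (ρ i) → ∀ j, st.node j = st.node i → j = i
  fst : ∀ e ∈ st.edges, st.node e.1 ≠ st.node (ρ e.1) →
    e.2.1 = st.node (ρ e.1) ∧ e.2.2 = cutValue s {e.1}
  snd : ∀ e ∈ st.edges, st.node e.2.1 ≠ st.node (ρ e.2.1) →
    e.1 = st.node (ρ e.2.1) ∧ e.2.2 = cutValue s {e.2.1}
  light : ∀ e ∈ st.edges, st.node e.1 = st.node (ρ e.1) → st.node e.2.1 = st.node (ρ e.2.1) →
    e.2.2 < M

variable {s : Similarity n} {ρ : Fin n → Fin n} {M : ℝ} {st : GHState n} {u v : Fin n}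
  {C : Finset (Fin n)}

/-- The invariant survives a split of `u` and `v` along a light cut between the blocks, and one
along `{u}` when `u` and `v` lie in one block. -/
lemma BlockInvariant.split (hI : BlockInvariant s ρ M st) (ht : st.IsTree)
    (h : st.IsFirstPair u v) (hu : u ∈ C) (hv : v ∉ C)
    (hC : ∀ i, i ≠ u → (i ∈ C ↔ ρ i ∈ C))
    (huC : (ρ u ∈ C ∧ cutValue s C < M) ∨ (ρ u ∉ C ∧ C = {u})) :
    BlockInvariant s ρ M (st.split s u v C) := by
  have hvu : v ≠ u := h.lt.ne'
  have huρ : st.node (ρ u) = u := by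
    by_contra hne
    refine hvu (hI.singleton u ?_ v ?_)
    · rw [h.node_left]
      exact Ne.symm hne
    · rw [h.node_right, h.node_left]
  have hvρ : st.node (ρ v) = u := by
    by_contra hne
    refine hvu (hI.singleton v ?_ u ?_).symm
    · rw [h.node_right]
      exact Ne.symm hne
    · rw [h.node_right, h.node_left]
  have hnv : ∀ a, st.node a = a → a ≠ v := by
    rintro a ha rfl
    exact hvu (ha.symm.trans h.node_right)
  set st' := st.split s u v C with hst'
  have hnode : ∀ i, st'.node i = if st.node i = u ∧ i ∉ C then v else st.node i :=
    h.split_node s C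
  have hnode_u : st'.node u = u := by rw [hnode, if_neg (by simp [hu]), h.node_left]
  have hnode_v : st'.node v = v := by rw [hnode, if_pos ⟨h.node_right, hv⟩]
  have hv_joined : st'.node v = st'.node (ρ v) := by
    rw [hnode_v, hnode, if_pos ⟨hvρ, fun hmem => hv ((hC v hvu).2 hmem)⟩]
  -- apart from `u`, the split separates no point from the greatest point of its block
  have hold : ∀ i, i ≠ u → st'.node i ≠ st'.node (ρ i) → st.node i ≠ st.node (ρ i) := by
    intro i hi hne heq
    apply hne
    simp only [hnode, heq, hC i hi]
  have hnew : ∀ i, st.node i ≠ st.node (ρ i) → i ≠ u ∧ i ≠ v ∧ st'.node i ≠ st'.node (ρ i) := by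
    intro i hi
    have hiu : st.node i ≠ u := by
      intro hiu
      have h1 := hI.singleton i hi u (by rw [hiu, h.node_left])
      have h2 := hI.singleton i hi v (by rw [hiu, h.node_right])
      exact hvu (h2.trans h1.symm)
    refine ⟨fun e => hiu (e ▸ h.node_left), fun e => hiu (e ▸ h.node_right), ?_⟩
    rw [hnode, if_neg (by simp [hiu]), hnode]
    split_ifs
    · exact hnv _ (ht.node_node i)
    · exact hi
  have hcoarse : ∀ i j, st'.node j = st'.node i → st.node j = st.node i := by
    intro i j hij
    rw [hnode, hnode] at hij
    split_ifs at hij with hj hi hi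
    · rw [hj.1, hi.1]
    · exact absurd hij.symm (hnv _ (ht.node_node i))
    · exact absurd hij (hnv _ (ht.node_node j))
    · exact hij
  -- one end `a` of an old edge
  have hend : ∀ a b w, (st.node a = a) → a ≠ b →
      (st.node a ≠ st.node (ρ a) → b = st.node (ρ a) ∧ w = cutValue s {a}) →
      st'.node (reattach u v C a b) ≠ st'.node (ρ (reattach u v C a b)) →
      reattach u v C b a = st'.node (ρ (reattach u v C a b)) ∧
        w = cutValue s {reattach u v C a b} := by
    intro a b w ha hab hedge hsep
    by_cases hmove : a = u ∧ b ∉ C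
    · simp only [reattach, if_pos hmove] at hsep
      exact absurd hv_joined hsep
    · have hre : reattach u v C a b = a := by simp only [reattach, if_neg hmove]
      rw [hre] at hsep ⊢
      have hau : a ≠ u := by
        rintro rfl
        rcases huC with ⟨hρ, -⟩ | ⟨-, rfl⟩
        · rw [hnode_u, hnode, if_neg (by simp [hρ]), huρ] at hsep
          exact hsep rfl
        · exact hmove ⟨rfl, by simpa using hab.symm⟩
      obtain ⟨hb, hw⟩ := hedge (hold a hau hsep)
      refine ⟨?_, hw⟩
      rw [hb]
      simp only [hnode, reattach, hC a hau]
  constructor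
  · intro i hi j hij
    by_cases hiu : i = u
    · subst hiu
      rcases huC with ⟨hρ, -⟩ | ⟨-, hCu⟩
      · rw [hnode_u, hnode, if_neg (by simp [hρ]), huρ] at hi
        exact absurd rfl hi
      · by_contra hji
        rw [hnode_u, hnode] at hij
        split_ifs at hij with hj
        · exact hvu hij
        · exact hj ⟨hij, by simp [hCu, hji]⟩
    · exact hI.singleton i (hold i hiu hi) j (hcoarse i j hij)
  · rw [h.split_edges]
    intro e he hsep
    rcases List.mem_cons.1 he with rfl | he
    · rcases huC with ⟨hρ, -⟩ | ⟨hρ, hCu⟩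
      · rw [hnode_u, hnode, if_neg (by simp [hρ]), huρ] at hsep
        exact absurd rfl hsep
      · refine ⟨?_, by rw [← hCu]⟩
        rw [hnode, if_pos ⟨huρ, hρ⟩]
    · obtain ⟨f, hf, rfl⟩ := List.mem_map.1 he
      exact hend _ _ _ (ht.fst_mem f hf) (ht.ne f hf) (hI.fst f hf) hsep
  · rw [h.split_edges]
    intro e he hsep
    rcases List.mem_cons.1 he with rfl | he
    · exact absurd hv_joined hsep
    · obtain ⟨f, hf, rfl⟩ := List.mem_map.1 he
      exact hend _ _ _ (ht.snd_mem f hf) (ht.ne f hf).symm (hI.snd f hf) hsep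
  · rw [h.split_edges]
    intro e he h1 h2
    rcases List.mem_cons.1 he with rfl | he
    · rcases huC with ⟨-, hlight⟩ | ⟨hρ, hCu⟩
      · exact hlight
      · rw [hnode_u, hnode, if_pos ⟨huρ, hρ⟩] at h1
        exact absurd h1.symm hvu
    · obtain ⟨f, hf, rfl⟩ := List.mem_map.1 he
      have hjoined : ∀ a b, st'.node (reattach u v C a b) = st'.node (ρ (reattach u v C a b)) →
          st.node a = st.node (ρ a) := by
        intro a b hab
        by_contra hsep
        obtain ⟨hau, -, hsep'⟩ := hnew a hsep
        simp only [reattach, hau, false_and, if_false] at hab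
        exact hsep' hab
      exact hI.light f hf (hjoined _ _ h1) (hjoined _ _ h2)

/-- The block of `u` is a cut in the contracted graph if `v` lies in a different block: its points
outside the supernode of `u` are supernodes by themselves, all of them adjacent to that of `u`. -/
lemma BlockInvariant.isContractedCut_block (hI : BlockInvariant s ρ M st) (ht : st.IsTree)
    (h : st.IsFirstPair u v) (huv : ρ u ≠ ρ v) :
    st.IsContractedCut u v (univ.filter fun i => ρ i = ρ u) := by
  have huρ : st.node (ρ u) = u := by
    by_contra hne
    refine h.lt.ne' (hI.singleton u ?_ v ?_)
    · rw [h.node_left]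
      exact Ne.symm hne
    · rw [h.node_right, h.node_left]
  refine ⟨by simp, by simpa using huv.symm, fun i hi => ?_, fun e he h1 h2 => ?_⟩
  · rw [h.node_left] at hi
    simp only [mem_filter, mem_univ, true_and]
    constructor
    · intro hiu
      have := hI.singleton i (by rwa [hiu, huρ]) (st.node i) (ht.node_node i)
      rwa [this]
    · intro hiu
      have := hI.singleton (st.node i) (by rwa [hiu, huρ, ht.node_node]) i (ht.node_node i).symm
      rwa [← this] at hiu
  · rw [h.node_left] at h1 h2
    simp only [mem_filter, mem_univ, true_and]
    constructor
    · intro hiu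
      have := (hI.fst e he (by rwa [hiu, huρ, ht.fst_mem e he])).1
      exact absurd (this.trans (hiu ▸ huρ)) h2
    · intro hiu
      have := (hI.snd e he (by rwa [hiu, huρ, ht.snd_mem e he])).1
      exact absurd (this.trans (hiu ▸ huρ)) h1

lemma blockInvariant_init (s : Similarity n) (ρ : Fin n → Fin n) (M : ℝ) :
    BlockInvariant s ρ M (init n) where
  singleton i hi := absurd rfl hi
  fst := by simp [init]
  snd := by simp [init]
  light := by simp [init]

end GHState

/-- In the minimum cut tree of a block similarity function, each point that is not the greatest of
its block is a leaf attached to that one, by an edge as heavy as the cut around the leaf. All other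
edges are light. -/
lemma mct_blockSimilarity (hn : 0 < n) {ρ : Fin n → Fin n} (hρ : IsMaxLabelling ρ) {M ε : ℝ}
    (hM : 0 < M) (hε : 0 < ε) (hMε : n * (n * ε) < M) :
    ∀ e ∈ mct (blockSimilarity ρ hM hε),
      (e.1 ≠ ρ e.1 → e.2.1 = ρ e.1 ∧ e.2.2 = cutValue (blockSimilarity ρ hM hε) {e.1}) ∧
      (e.2.1 ≠ ρ e.2.1 → e.1 = ρ e.2.1 ∧ e.2.2 = cutValue (blockSimilarity ρ hM hε) {e.2.1}) ∧
      (e.1 = ρ e.1 → e.2.1 = ρ e.2.1 → e.2.2 < M) := by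
  set s := blockSimilarity ρ hM hε with hs
  have hin : ∀ i j, ρ i = ρ j → s.toFun i j = M := fun i j hij => if_pos hij
  have hout : ∀ i j, ρ i ≠ ρ j → s.toFun i j = ε := fun i j hij => if_neg hij
  obtain ⟨st, hst, ht, hid, hI⟩ := GHState.exists_final hn s (GHState.BlockInvariant s ρ M)
    (GHState.blockInvariant_init s ρ M) (by
      intro st u v ht h hI
      by_cases huv : ρ u = ρ v
      · have hcut : st.minCut s u v = {u} := by
          refine GHState.minCut_eq_singleton h fun C hu hv => cutValue_singleton_le s ?_ hu hv
          intro j _ _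
          by_cases hj : ρ u = ρ j
          · rw [hin _ _ hj, hin _ _ (hj.symm.trans huv)]
          · rw [hout _ _ hj, hout _ _ fun hjv => hj (huv.trans hjv.symm)]
        have hvρ : u < ρ u := h.lt.trans_le (huv ▸ hρ.le v)
        rw [hcut]
        refine hI.split ht h (by simp) (by simpa using h.lt.ne') (fun i hi => ?_)
          (Or.inr ⟨by simpa using hvρ.ne', rfl⟩)
        have hiρ : ρ i ≠ u := by
          intro hiu
          have := hρ.idem i
          rw [hiu] at this
          exact hvρ.ne' this
        simp [hi, hiρ]
      · obtain ⟨⟨hu, hv, -⟩, hmin⟩ := GHState.isMinCut_minCut s h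
        have hlight : cutValue s (st.minCut s u v) < M := by
          refine (hmin _ (hI.isContractedCut_block ht h huv)).trans_lt (lt_of_le_of_lt ?_ hMε)
          set A := univ.filter fun i => ρ i = ρ u
          have hcard : ∀ B : Finset (Fin n), ((B.card : ℕ) : ℝ) ≤ n := fun B => by
            exact_mod_cast (Finset.card_le_univ B).trans_eq (Fintype.card_fin n)
          have hrow : ∀ i ∈ A, ∑ j ∈ Aᶜ, s.toFun i j ≤ n * ε := by
            intro i hi
            have : ∑ j ∈ Aᶜ, s.toFun i j = ∑ _j ∈ Aᶜ, ε := by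
              refine Finset.sum_congr rfl fun j hj => hout _ _ fun hij => ?_
              simp only [A, mem_compl, mem_filter, mem_univ, true_and] at hi hj
              exact hj (hij.symm.trans hi)
            rw [this, Finset.sum_const, nsmul_eq_mul]
            gcongr
            exact_mod_cast hcard _
          calc cutValue s A ≤ ∑ _i ∈ A, n * ε := Finset.sum_le_sum hrow
            _ = A.card * (n * ε) := by rw [Finset.sum_const, nsmul_eq_mul]
            _ ≤ n * (n * ε) := by gcongr; exact_mod_cast hcard _
        have hresp : ∀ i, i ∈ st.minCut s u v ↔ ρ i ∈ st.minCut s u v := by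
          intro i
          have hi : ρ i = ρ (ρ i) := (hρ.idem i).symm
          by_contra hne
          have hne := not_iff.1 hne
          by_cases h1 : i ∈ st.minCut s u v
          · have h2 : ρ i ∉ st.minCut s u v := fun h2 => (hne.2 h2) h1
            have := le_cutValue s h1 h2
            rw [hin _ _ hi] at this
            linarith
          · have := le_cutValue s (hne.1 h1) h1
            rw [hin _ _ hi.symm] at this
            linarith
        exact hI.split ht h hu hv (fun i _ => hresp i) (Or.inl ⟨(hresp u).1 hu, hlight⟩))
  rw [← hst]
  intro e he
  have h1 := hI.fst e he
  have h2 := hI.snd e he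
  have h3 := hI.light e he
  simp only [hid] at h1 h2 h3
  exact ⟨h1, h2, h3⟩

/-! ### Richness of Max-Sum -/

/-- Each block with `m` points contributes `m - 1` heavy edges to the minimum cut tree of a block
similarity function with `k` blocks. There are `n - 1` edges, so at most `k - 1` of them are light,
and all of these are cut: each remaining edge lies inside a block. -/
lemma sameCluster_maxSum_blockSimilarity {k : ℕ} {ρ : Fin n → Fin n} (hρ : IsMaxLabelling ρ)
    (hk : 1 ≤ k) (hcard : (univ.image ρ).card = k) {M ε : ℝ} (hM : 0 < M) (hε : 0 < ε)
    (hMε : n * (n * ε) < M) {i j : Fin n}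
    (hij : SameCluster (maxSum k (blockSimilarity ρ hM hε)) i j) : ρ i = ρ j := by
  classical
  have hn : 0 < n := i.pos
  set s := blockSimilarity ρ hM hε with hs
  obtain ⟨hlen, hconn, -⟩ := mct_tree hn s
  have hT := mct_blockSimilarity hn hρ hM hε hMε
  rw [← hs] at hT
  set heavy : WEdge n → Prop := fun e => e.1 ≠ ρ e.1 ∨ e.2.1 ≠ ρ e.2.1 with hheavy
  have hinside : ∀ e ∈ mct s, heavy e → ρ e.1 = ρ e.2.1 := by
    rintro e he (h | h)
    · rw [((hT e he).1 h).1, hρ.idem]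
    · rw [((hT e he).2.1 h).1, hρ.idem]
  have hweight : ∀ e ∈ mct s, heavy e → M ≤ e.2.2 := by
    have hle : ∀ a, a ≠ ρ a → M ≤ cutValue s {a} := by
      intro a ha
      refine le_trans (le_of_eq ?_) (le_cutValue s (mem_singleton_self a)
        (by simpa using Ne.symm ha : ρ a ∉ ({a} : Finset (Fin n))))
      exact (if_pos (hρ.idem a).symm).symm
    rintro e he (h | h)
    · rw [((hT e he).1 h).2]
      exact hle _ h
    · rw [((hT e he).2.1 h).2]
      exact hle _ h
  have hlight : ∀ e ∈ mct s, ¬ heavy e → e.2.2 < M := by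
    intro e he h
    simp only [hheavy, not_or, not_not] at h
    exact (hT e he).2.2 h.1 h.2
  -- every point that is not the greatest of its block has a heavy edge of its own
  have hheavy_count : n - k ≤ ((mct s).filter fun e => decide (heavy e)).length := by
    have hfix : (univ.filter fun a => ρ a = a) = univ.image ρ := by
      ext a
      simp only [mem_filter, mem_univ, true_and, mem_image]
      exact ⟨fun h => ⟨a, h⟩, by rintro ⟨b, rfl⟩; exact hρ.idem b⟩
    have hcompl : (univ.filter fun a => ¬ ρ a = a).card = n - k := by
      have := Finset.card_filter_add_card_filter_not (s := (univ : Finset (Fin n)))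
        (fun a => ρ a = a)
      rw [hfix, hcard, card_univ, Fintype.card_fin] at this
      omega
    rw [← hcompl]
    refine le_trans (Finset.card_le_card_of_injOn
      (t := ((mct s).filter fun e => decide (heavy e)).toFinset.image
        fun e => if e.1 = ρ e.1 then e.2.1 else e.1) id ?_ (Set.injOn_id _))
      (Finset.card_image_le.trans (List.toFinset_card_le _))
    intro a ha
    have ha : ρ a ≠ a := (mem_filter.1 ha).2
    obtain ⟨e, he, hea⟩ : ∃ e ∈ mct s, e.1 = a ∨ e.2.1 = a := by
      obtain ⟨p⟩ := hconn a (ρ a)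
      generalize ρ a = b at p ha
      cases p with
      | nil => exact absurd rfl ha
      | cons hadj _ =>
        obtain ⟨-, e, he, h | h⟩ := edgeGraph_adj.1 hadj
        · exact ⟨e, he, Or.inl h.1⟩
        · exact ⟨e, he, Or.inr h.2⟩
    refine mem_image.2 ⟨e, ?_, ?_⟩
    · rw [List.mem_toFinset, List.mem_filter, decide_eq_true_iff]
      refine ⟨he, ?_⟩
      rcases hea with rfl | rfl
      · exact Or.inl ha.symm
      · exact Or.inr ha.symm
    · rcases hea with rfl | rfl
      · exact if_neg ha.symm
      · have := ((hT e he).2.1 ha.symm).1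
        rw [if_pos (by rw [this, hρ.idem])]
        rfl
  have hlight_count : ((mct s).countP fun e => !decide (heavy e)) ≤ k - 1 := by
    have := List.length_eq_length_filter_add (l := mct s) (fun e => decide (heavy e))
    rw [List.countP_eq_length_filter]
    have hkn : k ≤ n := hcard ▸ (Finset.card_le_univ _).trans_eq (Fintype.card_fin n)
    omega
  refine rel_of_reachable (r := fun a b => ρ a = ρ b) ⟨fun _ => rfl, Eq.symm, Eq.trans⟩
    (fun e he => ?_) (sameCluster_minKCut.1 hij)
  rw [keptEdges, List.mem_filter, decide_eq_true_iff] at he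
  obtain ⟨he, hke⟩ := he
  refine hinside e he ?_
  by_contra hlt
  -- the edges that precede a light edge are light
  have hsub : ((mct s).countP fun f => decide (edgeKey f < edgeKey e)) + 1 ≤
      (mct s).countP fun e => !decide (heavy e) := by
    rw [Nat.add_one_le_iff]
    have hperm := List.perm_cons_erase he
    rw [hperm.countP_eq, hperm.countP_eq, List.countP_cons_of_neg (by simp),
      List.countP_cons_of_pos (by simpa using hlt), Nat.lt_add_one_iff]
    refine List.countP_mono_left fun f hf hfe => ?_
    have hf := List.mem_of_mem_erase hf
    simp only [decide_eq_true_eq, Bool.not_eq_eq_eq_not, Bool.not_true, decide_eq_false_iff_not]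
      at hfe ⊢
    intro hfh
    have hw : f.2.2 ≤ e.2.2 := by
      rcases Prod.Lex.toLex_lt_toLex.1 hfe with h | ⟨h, -⟩
      · exact h.le
      · exact h.le
    linarith [hweight f hf hfh, hlight e he hlt]
  omega

/-- The labelling that names each cluster by its greatest point. -/
def maxLabel (P : Partition n) (i : Fin n) : Fin n :=
  (P.part i).max' ⟨i, P.mem_part (mem_univ i)⟩

lemma maxLabel_mem (P : Partition n) (i : Fin n) : maxLabel P i ∈ P.part i :=
  Finset.max'_mem _ _

lemma maxLabel_eq_iff (P : Partition n) {i j : Fin n} :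
    maxLabel P i = maxLabel P j ↔ SameCluster P i j := by
  rw [sameCluster_iff_part]
  constructor
  · intro h
    have hi := P.part_eq_of_mem (P.part_mem.2 (mem_univ i)) (maxLabel_mem P i)
    have hj := P.part_eq_of_mem (P.part_mem.2 (mem_univ j)) (maxLabel_mem P j)
    rw [← hi, ← hj, h]
  · intro h
    simp only [maxLabel, h]

lemma isMaxLabelling_maxLabel (P : Partition n) : IsMaxLabelling (maxLabel P) where
  idem i := (maxLabel_eq_iff P).2 ⟨P.part i, P.part_mem.2 (mem_univ i), maxLabel_mem P i,
    P.mem_part (mem_univ i)⟩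
  le i := Finset.le_max' _ _ (P.mem_part (mem_univ i))

/-- Any similarity function can be transformed, consistently with any `k`-partitioning `P`, into a
block similarity function on which Max-Sum returns `P`. -/
lemma exists_transformation_maxSum {k : ℕ} (hk : 1 ≤ k) (hkn : k ≤ n) {P : Partition n}
    (hP : IsKPartition k P) (s : Similarity n) :
    ∃ s' : Similarity n, IsTransformation P s s' ∧ maxSum k s' = P := by
  classical
  have hn : 0 < n := by omega
  have : Nonempty (Fin n) := ⟨⟨0, hn⟩⟩
  obtain ⟨B, hB⟩ : ∃ B, ∀ p : Fin n × Fin n, s.toFun p.1 p.2 ≤ B := Finite.exists_le _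
  obtain ⟨q, hq⟩ := Finite.exists_min
    (fun p : Fin n × Fin n => if p.1 = p.2 then (1 : ℝ) else s.toFun p.1 p.2)
  set m : ℝ := if q.1 = q.2 then (1 : ℝ) else s.toFun q.1 q.2 with hm
  -- `m` is a lower bound for the similarity of distinct points, and `B` is an upper bound
  have hmpos : 0 < m := by
    rw [hm]
    split_ifs with h
    · exact one_pos
    · exact s.pos _ _ h
  have hMpos : 0 < max B 0 + n * (n * m) + 1 := by positivity
  refine ⟨blockSimilarity (maxLabel P) hMpos hmpos, ⟨fun i j hij => ?_, fun i j hij => ?_⟩, ?_⟩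
  · have : (blockSimilarity (maxLabel P) hMpos hmpos).toFun i j =
        max B 0 + n * (n * m) + 1 := if_pos ((maxLabel_eq_iff P).2 hij)
    rw [this]
    have h1 := hB (i, j)
    have h2 := le_max_left B 0
    have h3 : 0 ≤ n * (n * m) := by positivity
    simp only at h1
    linarith
  · have : (blockSimilarity (maxLabel P) hMpos hmpos).toFun i j = m :=
      if_neg fun h => hij ((maxLabel_eq_iff P).1 h)
    rw [this]
    have hne : i ≠ j := fun h => hij (h ▸ SameCluster.refl P i)
    simpa [hne] using hq (i, j)
  · refine eq_of_refines (fun i j hij => ?_) ?_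
    · refine (maxLabel_eq_iff P).1 (sameCluster_maxSum_blockSimilarity
        (isMaxLabelling_maxLabel P) hk ?_ hMpos hmpos ?_ hij)
      · rw [← card_parts_eq_of_label fun i j => (maxLabel_eq_iff P).symm]
        exact hP
      · have := le_max_right B 0
        linarith
    · rw [isPartitioningFunction_maxSum hk hkn, hP]

/-- All points are equally similar: the block similarity function with a single block. The value of
`ε`, which does not occur as a similarity, meets the smallness condition of
`mct_blockSimilarity`. -/
noncomputable def uniformSimilarity (n : ℕ) : Similarity n :=
  blockSimilarity (fun i => ⟨n - 1, Nat.sub_lt i.pos one_pos⟩) one_pos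
    (ε := 1 / (n * n + 1)) (by positivity)

lemma uniformSimilarity_toFun (i j : Fin n) : (uniformSimilarity n).toFun i j = 1 := if_pos rfl

lemma kRich_maxSum {k : ℕ} (hk : 1 ≤ k) (hkn : k ≤ n) : KRich k (maxSum (n := n) k) := by
  ext P
  constructor
  · rintro ⟨s, rfl⟩
    exact isPartitioningFunction_maxSum hk hkn s
  · intro hP
    obtain ⟨s, -, hs⟩ := exists_transformation_maxSum hk hkn hP (uniformSimilarity n)
    exact ⟨s, hs⟩

/-- The characterization of Max-Sum. Given `s`, richness of `F` yields a `t` with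
`F t = maxSum k s`; a transformation `t'` of `t` has this value under both `F` and Max-Sum, and then MCT-Consistency
gives `F s = F t'`. -/
lemma eq_maxSum {k : ℕ} (hk : 1 ≤ k) (hkn : k ≤ n) {F : Similarity n → Partition n}
    (hcons : Consistent F) (hrich : KRich k F) (hmct : MCTConsistent k F) : F = maxSum k := by
  funext s
  have hP : IsKPartition k (maxSum k s) := isPartitioningFunction_maxSum hk hkn s
  obtain ⟨t, ht⟩ : maxSum k s ∈ Set.range F := hrich.symm ▸ hP
  obtain ⟨t', htr, ht'⟩ := exists_transformation_maxSum hk hkn hP t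
  rw [← ht] at htr
  rw [hmct s t' ht'.symm, hcons t t' htr, ht]

/-! ### Max-Sum followed by a permutation -/

lemma mctCuts_apply {k : ℕ} (hk : 1 ≤ k) (hkn : k ≤ n) (σ : Equiv.Perm (KPartition n k))
    (s : Similarity n) :
    mctCuts σ s = σ ⟨maxSum k s, isPartitioningFunction_maxSum hk hkn s⟩ :=
  letI := Classical.decPred (IsKPartition (n := n) k)
  Equiv.Perm.ofSubtype_apply_of_mem _ _

lemma kRich_mctCuts {k : ℕ} (hk : 1 ≤ k) (hkn : k ≤ n) (σ : Equiv.Perm (KPartition n k)) :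
    KRich k (mctCuts σ) := by
  ext P
  constructor
  · rintro ⟨s, rfl⟩
    rw [mctCuts_apply hk hkn]
    exact (σ _).2
  · intro hP
    obtain ⟨s, hs⟩ : (σ.symm ⟨P, hP⟩).1 ∈ Set.range (maxSum (n := n) k) :=
      (kRich_maxSum hk hkn).symm ▸ (σ.symm ⟨P, hP⟩).2
    refine ⟨s, ?_⟩
    rw [mctCuts_apply hk hkn]
    simp [hs]

lemma mctConsistent_mctCuts {k : ℕ} (σ : Equiv.Perm (KPartition n k)) :
    MCTConsistent k (mctCuts σ) := by
  intro s s' h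
  unfold mctCuts maxSum
  rw [h]

lemma mctCuts_ne_maxSum {k : ℕ} (hk : 1 ≤ k) (hkn : k ≤ n) {σ : Equiv.Perm (KPartition n k)}
    (hσ : σ ≠ 1) : mctCuts σ ≠ maxSum k := by
  intro heq
  apply hσ
  ext1 P
  obtain ⟨s, hs⟩ : P.1 ∈ Set.range (maxSum (n := n) k) := (kRich_maxSum hk hkn).symm ▸ P.2
  have h := congrFun heq s
  rw [mctCuts_apply hk hkn] at h
  have hP : (⟨maxSum k s, isPartitioningFunction_maxSum hk hkn s⟩ : KPartition n k) = P :=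
    Subtype.ext hs
  rw [hP, hs] at h
  exact Subtype.ext h

lemma scaleInvariant_mctCuts {k : ℕ} (σ : Equiv.Perm (KPartition n k)) :
    ScaleInvariant (mctCuts σ) := by
  intro s α hα
  unfold mctCuts
  rw [scaleInvariant_maxSum]

/-! ### Single-Linkage and Max-Sum -/

lemma kRich_singleLinkage {k : ℕ} (hk : 1 ≤ k) (hkn : k ≤ n) :
    KRich k (singleLinkage (n := n) k) := by
  ext P
  constructor
  · rintro ⟨s, rfl⟩
    exact isPartitioningFunction_singleLinkage hk hkn s
  · intro hP
    refine ⟨blockSimilarity (maxLabel P) two_pos one_pos,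
      singleLinkage_eq_of_prefers hk hkn hP fun c hc => ?_⟩
    obtain ⟨q, hPq, hq, hcq⟩ := exists_lt_of_exists_ne hc
    refine ⟨q, hPq, hq, hcq, fun p hPp _ _ => Or.inl ?_⟩
    have h1 : (blockSimilarity (maxLabel P) two_pos one_pos).toFun p.1 p.2 = 1 :=
      if_neg fun h => hPp ((maxLabel_eq_iff P).1 h)
    have h2 : (blockSimilarity (maxLabel P) two_pos one_pos).toFun q.1 q.2 = 2 :=
      if_pos ((maxLabel_eq_iff P).2 hPq)
    rw [h1, h2]
    norm_num

/-- On equally similar points, Single-Linkage merges the first two points. -/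
lemma sameCluster_singleLinkage_uniform {k : ℕ} (hkn : k < n) (hn : 2 ≤ n) :
    SameCluster (singleLinkage k (uniformSimilarity n)) ⟨0, by omega⟩ ⟨1, by omega⟩ := by
  rw [sameCluster_singleLinkage]
  refine slStep_iterate_eq_of_le (a := 1) _ (by omega) ?_
  set z : Fin n := ⟨0, by omega⟩
  set o : Fin n := ⟨1, by omega⟩
  have hzo : z < o := Nat.zero_lt_one
  obtain ⟨p, hp, -, hbest, heq⟩ := slStep_spec (uniformSimilarity n) id ⟨z, o, hzo.ne⟩
  have hle : toLex p ≤ toLex (z, o) := by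
    rcases hbest (z, o) hzo hzo.ne with h | ⟨-, h⟩
    · rw [uniformSimilarity_toFun, uniformSimilarity_toFun] at h
      exact absurd h (lt_irrefl _)
    · exact h
  have hz : p.1 = z := by
    rcases Prod.Lex.toLex_le_toLex.1 hle with h | ⟨h, -⟩
    · exact absurd (Fin.lt_def.1 h) (Nat.not_lt_zero _)
    · exact h
  have ho : p.2 = o := by
    rcases Prod.Lex.toLex_le_toLex.1 hle with h | ⟨-, h⟩
    · exact absurd hz h.ne
    · refine le_antisymm h (Fin.le_def.2 ?_)
      have := Fin.lt_def.1 hp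
      rw [hz] at this
      exact this
  rw [Function.iterate_one, heq]
  simp [hz, ho]

/-- On equally similar points, the minimum cut tree is a star around the last point with equal
weights, and the first edge that Max-Sum cuts is the one at the first point. -/
lemma not_sameCluster_maxSum_uniform {k : ℕ} (hk : 2 ≤ k) (hn : 2 ≤ n) :
    ¬ SameCluster (maxSum k (uniformSimilarity n)) ⟨0, by omega⟩ ⟨1, by omega⟩ := by
  classical
  set s := uniformSimilarity n with hs
  set z : Fin n := ⟨0, by omega⟩ with hz
  set l : Fin n := ⟨n - 1, by omega⟩ with hl
  have hlast : ∀ i, i ≤ l := fun i => Fin.le_def.2 (Nat.le_sub_one_of_lt i.2)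
  have hcut : ∀ i, cutValue s {i} = n - 1 := by
    intro i
    simp only [cutValue, hs, uniformSimilarity_toFun, Finset.sum_const,
      Finset.card_compl, Finset.card_singleton, Fintype.card_fin, nsmul_eq_mul, mul_one,
      Nat.cast_one, one_mul]
    rw [Nat.cast_sub (by omega), Nat.cast_one]
  have hε : n * (n * (1 / (n * n + 1))) < (1 : ℝ) := by
    rw [← mul_assoc, mul_one_div, div_lt_one (by positivity)]
    linarith
  have hT : ∀ e ∈ mct s, (e.1 ≠ l → e.2.1 = l ∧ e.2.2 = n - 1) ∧
      (e.2.1 ≠ l → e.1 = l ∧ e.2.2 = n - 1) := by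
    intro e he
    obtain ⟨h1, h2, -⟩ := mct_blockSimilarity (ρ := fun _ => l) (by omega)
      ⟨fun _ => rfl, hlast⟩ one_pos (by positivity) hε e he
    refine ⟨fun h => ?_, fun h => ?_⟩
    · have := h1 h
      exact ⟨this.1, this.2.trans (hcut _)⟩
    · have := h2 h
      exact ⟨this.1, this.2.trans (hcut _)⟩
  have hne := (mct_tree (by omega) s).2.2
  have hzl : z ≠ l := by simp [hz, hl]; omega
  have hzle : ∀ i, z ≤ i := fun i => Fin.le_def.2 (Nat.zero_le _)
  -- no edge has a smaller key than an edge at `z`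
  have hleast : ∀ e ∈ mct s, e.1 = z ∨ e.2.1 = z → ∀ f ∈ mct s, ¬ edgeKey f < edgeKey e := by
    have hkey : ∀ f ∈ mct s, edgeKey f = toLex ((n - 1 : ℝ), toLex (min f.1 f.2.1, l)) := by
      intro f hf
      by_cases h1 : f.1 = l
      · obtain ⟨-, hw⟩ := (hT f hf).2 (h1 ▸ (hne f hf).symm)
        simp only [edgeKey, hw, h1, max_eq_left (hlast _)]
      · obtain ⟨h2, hw⟩ := (hT f hf).1 h1
        simp only [edgeKey, hw, h2, max_eq_right (hlast _)]
    intro e he hez f hf hlt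
    have hmin : min e.1 e.2.1 = z := by
      rcases hez with h | h
      · rw [h, min_eq_left (hzle _)]
      · rw [h, min_eq_right (hzle _)]
    rw [hkey e he, hkey f hf, hmin] at hlt
    simp only [Prod.Lex.toLex_lt_toLex, lt_irrefl, true_and, false_or, and_false, or_false] at hlt
    exact hlt.not_ge (hzle _)
  intro hsame
  have hiso := rel_of_reachable (r := fun a b => a = z ↔ b = z)
    ⟨fun _ => Iff.rfl, Iff.symm, Iff.trans⟩ (fun e he => ?_) (sameCluster_minKCut.1 hsame)
  · have := Fin.val_eq_of_eq (hiso.1 rfl)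
    simp [hz] at this
  · rw [keptEdges, List.mem_filter, decide_eq_true_iff] at he
    obtain ⟨he, hke⟩ := he
    have hends : ¬ (e.1 = z ∨ e.2.1 = z) := by
      intro hez
      have : (mct s).countP (fun f => decide (edgeKey f < edgeKey e)) = 0 :=
        List.countP_eq_zero.2 fun f hf => by simpa using hleast e he hez f hf
      omega
    rw [not_or] at hends
    exact iff_of_false hends.1 hends.2

/-- Single-Linkage and Max-Sum differ on equally similar points. -/
lemma singleLinkage_ne_maxSum {k : ℕ} (hk : 2 ≤ k) (hkn : k < n) :
    singleLinkage (n := n) k ≠ maxSum k := fun h =>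
  not_sameCluster_maxSum_uniform hk (by omega)
    (h ▸ sameCluster_singleLinkage_uniform hkn (by omega))

/-! ### The constant partitioning -/

lemma sameCluster_constantPartitioning {k : ℕ} {s : Similarity n} {i j : Fin n} :
    SameCluster (constantPartitioning k s) i j ↔ max (i : ℕ) (n - k) = max (j : ℕ) (n - k) := by
  classical
  unfold constantPartitioning
  rw [sameCluster_ofSetoid]
  exact Setoid.ker_def

lemma isPartitioningFunction_constantPartitioning {k : ℕ} (hk : 1 ≤ k) (hkn : k ≤ n) :
    IsPartitioningFunction k (constantPartitioning (n := n) k) := by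
  intro s
  unfold IsKPartition
  rw [card_parts_eq_of_label fun i j => sameCluster_constantPartitioning]
  have : univ.image (fun i : Fin n => max (i : ℕ) (n - k)) = Finset.Ico (n - k) n := by
    ext a
    simp only [mem_image, mem_univ, true_and, mem_Ico]
    constructor
    · rintro ⟨i, rfl⟩
      have := i.2
      omega
    · intro ha
      exact ⟨⟨a, ha.2⟩, max_eq_left ha.1⟩
  rw [this, Nat.card_Ico]
  omega

lemma not_kRich_constantPartitioning {k : ℕ} (hk : 2 ≤ k) (hkn : k < n) :
    ¬ KRich k (constantPartitioning (n := n) k) := by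
  intro h
  obtain ⟨s, hs⟩ : maxSum k (uniformSimilarity n) ∈ Set.range (constantPartitioning (n := n) k) :=
    h.symm ▸ isPartitioningFunction_maxSum (by omega) hkn.le _
  refine not_sameCluster_maxSum_uniform (n := n) hk (by omega) ?_
  rw [← hs, sameCluster_constantPartitioning]
  simp only
  omega

end Clustering

theorem theorem2 (n k : ℕ) (hn : 2 ≤ n) (hk : 1 ≤ k) (hkn : k ≤ n) :
    -- Consistency cannot be dropped: the MCT cuts family
    ((∀ σ : Equiv.Perm (Clustering.KPartition n k),
        Clustering.IsPartitioningFunction k (Clustering.mctCuts σ) ∧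
        Clustering.ScaleInvariant (Clustering.mctCuts σ) ∧
        Clustering.KRich k (Clustering.mctCuts σ) ∧
        Clustering.MCTConsistent k (Clustering.mctCuts σ) ∧
        (σ ≠ 1 → Clustering.mctCuts σ ≠ Clustering.maxSum k ∧
          ¬ Clustering.Consistent (Clustering.mctCuts σ))) ∧
      (2 ≤ k → k < n → ∃ σ : Equiv.Perm (Clustering.KPartition n k), σ ≠ 1)) ∧
    -- MCT-Consistency cannot be dropped: Single-Linkage
    (Clustering.IsPartitioningFunction k (Clustering.singleLinkage (n := n) k) ∧
      Clustering.ScaleInvariant (Clustering.singleLinkage (n := n) k) ∧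
      Clustering.Consistent (Clustering.singleLinkage (n := n) k) ∧
      Clustering.KRich k (Clustering.singleLinkage (n := n) k) ∧
      (2 ≤ k → k < n →
        Clustering.singleLinkage (n := n) k ≠ Clustering.maxSum k ∧
        ¬ Clustering.MCTConsistent k (Clustering.singleLinkage (n := n) k))) ∧
    -- k-Richness cannot be dropped: the constant partitioning
    (Clustering.IsPartitioningFunction k (Clustering.constantPartitioning (n := n) k) ∧
      Clustering.ScaleInvariant (Clustering.constantPartitioning (n := n) k) ∧
      Clustering.Consistent (Clustering.constantPartitioning (n := n) k) ∧
      Clustering.MCTConsistent k (Clustering.constantPartitioning (n := n) k) ∧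
      (2 ≤ k → k < n →
        Clustering.constantPartitioning (n := n) k ≠ Clustering.maxSum k ∧
        ¬ Clustering.KRich k (Clustering.constantPartitioning (n := n) k))) := by
  open Clustering in
  refine ⟨⟨fun σ => ⟨fun s => ?_, scaleInvariant_mctCuts σ, kRich_mctCuts hk hkn σ,
      mctConsistent_mctCuts σ, fun hσ => ⟨mctCuts_ne_maxSum hk hkn hσ, fun hcons => ?_⟩⟩,
      fun h2k hk' => ?_⟩,
    ⟨isPartitioningFunction_singleLinkage hk hkn, scaleInvariant_singleLinkage k,
      consistent_singleLinkage hk hkn, kRich_singleLinkage hk hkn, fun h2k hk' =>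
      ⟨singleLinkage_ne_maxSum h2k hk', fun hmct => ?_⟩⟩,
    ⟨isPartitioningFunction_constantPartitioning hk hkn, fun _ _ _ => rfl, fun _ _ _ => rfl,
      fun _ _ _ => rfl, fun h2k hk' =>
      ⟨fun heq => not_kRich_constantPartitioning h2k hk' (heq ▸ kRich_maxSum hk hkn),
        not_kRich_constantPartitioning h2k hk'⟩⟩⟩
  · rw [mctCuts_apply hk hkn]
    exact (σ _).2
  · exact mctCuts_ne_maxSum hk hkn hσ
      (eq_maxSum hk hkn hcons (kRich_mctCuts hk hkn σ) (mctConsistent_mctCuts σ))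
  · -- the values of Single-Linkage and Max-Sum on equally similar points are distinct
    let s := uniformSimilarity n
    let P : KPartition n k := ⟨singleLinkage k s, isPartitioningFunction_singleLinkage hk hkn s⟩
    let Q : KPartition n k := ⟨maxSum k s, isPartitioningFunction_maxSum hk hkn s⟩
    have hPQ : P ≠ Q := by
      intro h
      refine not_sameCluster_maxSum_uniform h2k hn ?_
      have : singleLinkage k s = maxSum k s := congrArg Subtype.val h
      exact this ▸ sameCluster_singleLinkage_uniform hk' hn
    classical
    exact ⟨Equiv.swap P Q, fun h => hPQ (Equiv.swap_eq_one_iff.1 h)⟩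
  · exact singleLinkage_ne_maxSum h2k hk'
      (eq_maxSum hk hkn (consistent_singleLinkage hk hkn) (kRich_singleLinkage hk hkn) hmct)
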